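/- Fix an integer $d\ge 1$ and write $\pi_1(x^1,\dots,x^d)=x^1$. A *self-avoiding walk* of $n$ steps is a sequence $\omega=[\omega_0,\dots,\omega_n]$ of distinct points of $\mathbb Z^d$ with $\omega_0=0$ and $|\omega_{j+1}-\omega_j|=1$ for $0\le j<n$; let $c_n$ be the number of such walks. Let $\Upsilon_n$ be the set of $n$-step self-avoiding walks with $\pi_1\omega_j>0$ for $1\le j\le n$, let $\upsilon_n=\#\Upsilon_n$, and let $\mu_n$ be the uniform probability measure on $\Upsilon_n$. We regard $\mu_n$ as a probability measure on the space $(\mathbb Z^d)^{\mathbb N}$ of infinite sequences, with the product of the discrete topologies, by letting a finite walk stay at its endpoint forever. A walk $\omega\in\Upsilon_n$ is a *bridge* if $\pi_1\omega_0<\pi_1\omega_j\le\pi_1\omega_n$ for all $1\le j\le n$. A *renewal time* of $\omega\in\Upsilon_n$ is a $j\in\{1,\dots,n-1\}$ such that $\pi_1\omega_k\le\pi_1\omega_j<\pi_1\omega_m$ whenever $0\le k\le j<m\le n$. An *irreducible bridge* of length $k\ge 1$ is a bridge in $\Upsilon_k$ without renewal time. The concatenation of bridges $\chi^1,\chi^2,\dots$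 is the infinite walk that starts at $0$ and follows successively $\chi^1$, then $\chi^2$ translated so as to start at the endpoint of $\chi^1$, and so on. Then the following hold. 1. The limit $\beta=\lim_{n\to\infty}c_n^{1/n}$ (the connective constant of $\mathbb Z^d$) exists, and $\lim_{n\to\infty}\upsilon_{n+1}/\upsilon_n=\beta$. 2. There is a probability measure $\kappa$ on the set of all irreducible bridges that gives each irreducible bridge of length $k$ the probability $\beta^{-k}$, and, as $n\to\infty$, $\mu_n$ converges weakly to the law of the concatenation of an i.i.d. sequence $\chi^1,\chi^2,\dots$ of irreducible bridges with common law $\kappa$. -/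

import Mathlib

open MeasureTheory ProbabilityTheory Filter Topology

/-- Sites of the hypercubic lattice `ℤ^d`. Its product topology is discrete. -/
abbrev Site (d : ℕ) : Type := Fin d → ℤ

/-- `n`-step nearest neighbour self-avoiding walks `[ω 0, …, ω n]` in `ℤ^d` with `ω 0 = 0`.
A finite walk is stored as a function on `ℕ` which stays at its endpoint after time `n`; in this
way walks of all lengths, finite and infinite, are points of the one path space `ℕ → Site d`. -/
def selfAvoidingWalks (d n : ℕ) : Set (ℕ → Site d) :=
  {ω | ω 0 = 0 ∧ (∀ j < n, ∑ i, |ω (j + 1) i - ω j i| = 1) ∧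
    Set.InjOn ω (Set.Iic n) ∧ ∀ j, n ≤ j → ω j = ω n}

/-- The number of `n`-step self-avoiding walks in `ℤ^d` starting at `0`. -/
noncomputable def sawCount (d n : ℕ) : ℕ := (selfAvoidingWalks d n).ncard

/-- The connective constant `β = lim_n (sawCount d n)^(1/n)` of `ℤ^d`. -/
noncomputable def connectiveConstant (d : ℕ) : ℝ :=
  limUnder atTop (fun n : ℕ => (sawCount d n : ℝ) ^ (1 / (n : ℝ)))

/-- `n`-step self-avoiding walks in `ℤ^d` starting at `0` whose first coordinate (the coordinate
with index `0`) is positive at all times `1, …, n`. -/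
def halfSpaceWalks (d n : ℕ) [NeZero d] : Set (ℕ → Site d) :=
  {ω | ω ∈ selfAvoidingWalks d n ∧ ∀ j, 1 ≤ j → j ≤ n → 0 < ω j 0}

/-- The number of `n`-step half-space self-avoiding walks. -/
noncomputable def halfSpaceCount (d n : ℕ) [NeZero d] : ℕ := (halfSpaceWalks d n).ncard

/-- The `n`-step walk `ω` is a bridge. -/
def IsBridge {d : ℕ} [NeZero d] (n : ℕ) (ω : ℕ → Site d) : Prop :=
  ∀ j, 1 ≤ j → j ≤ n → ω 0 0 < ω j 0 ∧ ω j 0 ≤ ω n 0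

/-- `j` is a renewal time of the `n`-step walk `ω`. -/
def IsRenewalTime {d : ℕ} [NeZero d] (n : ℕ) (ω : ℕ → Site d) (j : ℕ) : Prop :=
  1 ≤ j ∧ j < n ∧ ∀ k m, k ≤ j → j < m → m ≤ n → ω k 0 ≤ ω j 0 ∧ ω j 0 < ω m 0

/-- Irreducible bridges starting at `0`: self-avoiding bridges with at least one step and without
renewal time. -/
structure IrreducibleBridge (d : ℕ) [NeZero d] where
  /-- the number of steps -/
  length : ℕ
  /-- the walk, staying at its endpoint after time `length` -/
  path : ℕ → Site d
  length_pos : 1 ≤ length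
  path_mem : path ∈ halfSpaceWalks d length
  isBridge : IsBridge length path
  irreducible : ∀ j, ¬ IsRenewalTime length path j

/-- Every set of irreducible bridges is measurable (there are countably many of them). -/
instance (d : ℕ) [NeZero d] : MeasurableSpace (IrreducibleBridge d) := ⊤

/-- The time at which the `m`-th bridge starts in the concatenation `χ 0 ⊕ χ 1 ⊕ ⋯`. -/
def startTime {d : ℕ} [NeZero d] (χ : ℕ → IrreducibleBridge d) (m : ℕ) : ℕ :=
  ∑ i ∈ Finset.range m, (χ i).length

/-- The infinite walk `χ 0 ⊕ χ 1 ⊕ ⋯` obtained by concatenation, each bridge being translated to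
start at the endpoint of the previous one. At time `t` bridge `i` has been followed for
`t - startTime χ i` steps (truncated subtraction; no step if it has not started), a completed
bridge contributes its total displacement, and only bridges with index `i < t` can have made a
step. See `concatenate_startTime_add`. -/
def concatenate {d : ℕ} [NeZero d] (χ : ℕ → IrreducibleBridge d) : ℕ → Site d :=
  fun t => ∑ i ∈ Finset.range t, (χ i).path (t - startTime χ i)

lemma le_startTime {d : ℕ} [NeZero d] (χ : ℕ → IrreducibleBridge d) (m : ℕ) :
    m ≤ startTime χ m := by
  induction m with
  | zero => simp
  | succ m ih =>
    have := (χ m).length_pos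
    simp only [startTime, Finset.sum_range_succ] at ih ⊢
    omega

lemma startTime_mono {d : ℕ} [NeZero d] (χ : ℕ → IrreducibleBridge d) :
    Monotone (startTime χ) := fun _ _ h =>
  Finset.sum_le_sum_of_subset (Finset.range_mono h)

/-- Between the start of bridge `m` and its end, the concatenation follows bridge `m`, translated
by the sum of the displacements of the previous bridges. -/
lemma concatenate_startTime_add {d : ℕ} [NeZero d] (χ : ℕ → IrreducibleBridge d) (m j : ℕ)
    (hj : j ≤ (χ m).length) :
    concatenate χ (startTime χ m + j) =
      ∑ i ∈ Finset.range m, (χ i).path (χ i).length + (χ m).path j := by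
  have h0 : ∀ i, m < i → (χ i).path (startTime χ m + j - startTime χ i) = 0 := by
    intro i hi
    have h1 : startTime χ (m + 1) ≤ startTime χ i := startTime_mono χ hi
    have h2 : startTime χ (m + 1) = startTime χ m + (χ m).length := by
      simp [startTime, Finset.sum_range_succ]
    rw [show startTime χ m + j - startTime χ i = 0 by omega]
    exact (χ i).path_mem.1.1
  have hsum : ∀ N, m + 1 ≤ N →
      ∑ i ∈ Finset.range N, (χ i).path (startTime χ m + j - startTime χ i) =
      ∑ i ∈ Finset.range (m + 1), (χ i).path (startTime χ m + j - startTime χ i) := by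
    intro N hN
    refine (Finset.sum_subset (Finset.range_mono hN) ?_).symm
    intro i _ hi
    exact h0 i (by simpa using hi)
  have hm : ∑ i ∈ Finset.range (m + 1), (χ i).path (startTime χ m + j - startTime χ i) =
      ∑ i ∈ Finset.range m, (χ i).path (χ i).length + (χ m).path j := by
    rw [Finset.sum_range_succ, Nat.add_sub_cancel_left]
    congr 1
    refine Finset.sum_congr rfl fun i hi => ?_
    have h1 : startTime χ (i + 1) ≤ startTime χ m :=
      startTime_mono χ (by simpa using hi)
    have h2 : startTime χ (i + 1) = startTime χ i + (χ i).length := by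
      simp [startTime, Finset.sum_range_succ]
    exact (χ i).path_mem.1.2.2.2 _ (by omega)
  rw [← hm]
  unfold concatenate
  have hle := le_startTime χ m
  by_cases hN : m + 1 ≤ startTime χ m + j
  · exact hsum _ hN
  · have hj0 : j = 0 := by omega
    have hs : startTime χ m = m := by omega
    subst hj0
    rw [hs, Finset.sum_range_succ]
    simp only [add_zero, hs, Nat.sub_self]
    rw [(χ m).path_mem.1.1, add_zero]

lemma selfAvoidingWalks_finite (d n : ℕ) : (selfAvoidingWalks d n).Finite := by
  have hbd : ∀ ω ∈ selfAvoidingWalks d n, ∀ j ≤ n, ∀ i, |ω j i| ≤ j := by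
    intro ω hω j
    induction j with
    | zero => intro _ i; simp [hω.1]
    | succ j ih =>
      intro hj i
      have h1 := ih (by omega) i
      have h2 := hω.2.1 j (by omega)
      have h3 : |ω (j + 1) i - ω j i| ≤ 1 := by
        rw [← h2]
        exact Finset.single_le_sum (f := fun i => |ω (j + 1) i - ω j i|)
          (fun _ _ => abs_nonneg _) (Finset.mem_univ i)
      push_cast
      rw [abs_le] at *
      constructor <;> linarith [h1.1, h1.2, h3.1, h3.2]
  let r : (ℕ → Site d) → (Fin (n + 1) → Site d) := fun ω j => ω j
  refine Set.Finite.of_finite_image (f := r) ?_ ?_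
  · refine (Set.finite_Icc (fun _ _ => -(n : ℤ) : Fin (n + 1) → Site d) (fun _ _ => n)).subset ?_
    rintro _ ⟨ω, hω, rfl⟩
    have h : ∀ (j : Fin (n + 1)) i, |ω j i| ≤ n := fun j i =>
      (hbd ω hω j (by omega) i).trans (by have := j.2; omega)
    exact ⟨fun j i => (abs_le.1 (h j i)).1, fun j i => (abs_le.1 (h j i)).2⟩
  · intro ω hω ω' hω' h
    have h' : ∀ j ≤ n, ω j = ω' j := fun j hj => congrFun h ⟨j, by omega⟩
    funext j
    rcases le_total j n with hj | hj
    · exact h' j hj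
    · rw [hω.2.2.2 j hj, hω'.2.2.2 j hj, h' n le_rfl]

lemma halfSpaceWalks_finite (d n : ℕ) [NeZero d] : (halfSpaceWalks d n).Finite :=
  (selfAvoidingWalks_finite d n).subset fun _ h => h.1

lemma halfSpaceWalks_nonempty (d n : ℕ) [NeZero d] : (halfSpaceWalks d n).Nonempty := by
  refine ⟨fun j => Pi.single 0 ((min j n : ℕ) : ℤ), ⟨by simp, ?_, ?_, ?_⟩, ?_⟩
  · intro j hj
    rw [Finset.sum_eq_single 0]
    · simp only [Pi.single_eq_same]
      rw [min_eq_left (by omega), min_eq_left (by omega)]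
      simp
    · intro i _ hi
      simp [Pi.single_eq_of_ne hi]
    · simp
  · intro j hj k hk h
    have := congrFun h 0
    simp only [Pi.single_eq_same, Set.mem_Iic] at *
    rw [min_eq_left hj, min_eq_left hk] at this
    exact_mod_cast this
  · intro j hj
    simp [min_eq_right hj]
  · intro j h1 h2
    simp only [Pi.single_eq_same]
    rw [min_eq_left h2]
    exact_mod_cast h1

/-- The uniform probability measure on `n`-step half-space self-avoiding walks, as a measure on
the path space `ℕ → ℤ^d` with its product topology and product σ-algebra. -/
noncomputable def halfSpaceMeasure (d n : ℕ) [NeZero d] : ProbabilityMeasure (ℕ → Site d) :=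
  ⟨uniformOn (halfSpaceWalks d n),
    isProbabilityMeasure_uniformOn (halfSpaceWalks_finite d n) (halfSpaceWalks_nonempty d n)⟩

lemma measurable_startTime {d : ℕ} [NeZero d] (m : ℕ) :
    Measurable (fun χ : ℕ → IrreducibleBridge d => startTime χ m) :=
  Finset.measurable_sum _ fun i _ =>
    (measurable_from_top (f := IrreducibleBridge.length)).comp (measurable_pi_apply i)

lemma measurable_concatenate (d : ℕ) [NeZero d] : Measurable (concatenate (d := d)) := by
  refine measurable_pi_lambda _ fun t => Finset.measurable_sum _ fun i _ => ?_
  have h : Measurable (fun p : IrreducibleBridge d × ℕ => p.1.path (t - p.2)) :=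
    measurable_from_prod_countable_left fun _ => measurable_from_top
  exact h.comp ((measurable_pi_apply i).prodMk (measurable_startTime i))

/-- The law of `χ 0 ⊕ χ 1 ⊕ ⋯` when `χ 0, χ 1, …` are independent with common law `κ`. -/
noncomputable def concatenationLaw {d : ℕ} [NeZero d]
    (κ : ProbabilityMeasure (IrreducibleBridge d)) : ProbabilityMeasure (ℕ → Site d) :=
  ⟨(Measure.infinitePi fun _ : ℕ => (κ : Measure (IrreducibleBridge d))).map concatenate,
    Measure.isProbabilityMeasure_map (measurable_concatenate d).aemeasurable⟩

open scoped NNReal ENNReal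

/-! ### Operations on walks -/

/-! Write u_n for the number of half-space walks and c_n for the number of all walks. Cutting walks
makes c_n submultiplicative, so Fekete's lemma gives β together with c_n ≥ β^n.

Everything rests on Kesten's relation `tsum_inv_pow_eq_one`: the weights β^(-k) of irreducible
bridges sum to 1. They sum to at most 1, because an irreducible bridge followed by a half-space walk
is a half-space walk that determines the bridge. Hence u_n ≥ Σ_b u_(n-|b|), and a sum above 1 would
force growth faster than β. They sum to at least 1 because otherwise the generating functions at 1/β
of bridges (a geometric series), of half-space walks (the Hammersley–Welsh unfolding into bridges)
and of all walks would be finite, contradicting c_n ≥ β^n.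

For the ratio, the same argument is run with a weight s < 1 for each hook, a detour in a direction v
orthogonal to the first coordinate. Since some irreducible bridge contains a hook, the weighted
irreducible series at 1/β is below 1, so the weighted growth rate is below β and walks with few
hooks are exponentially rare. Inserting a hook adds two steps, and walks with a marked free slot
correspond to longer walks with a marked hook. So the mean over n-step walks of X = slots/hooks is
roughly u_(n+2)/u_n, and inserting twice shows that the mean of X² is at most roughly u_(n+4)/u_n.
Cauchy–Schwarz makes u_(n+2)/u_n increasing up to O(1/n), and an almost increasing ratio compatible
with exponential growth converges, here to β².

Passing from two steps to one uses the renewal inequality again. Divide u_(n+1) ≥ Σ_b u_(n+1-|b|) by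
u_(n+1) and separate the parities of |b|. All two-step ratios are known, so Kesten's relation bounds
limsup u_n/u_(n+1) by 1/β; the matching bound follows from the two-step limit.

For weak convergence it suffices to bound liminf μ_n(G) from below for open G. Conditioning on the
first irreducible bridge gives μ_n(G) at least the sum of (u_(n-|b|)/u_n) μ_(n-|b|)(walks which,
joined to b, lie in G), and the factors tend to β^(-|b|). Iterating over m bridges gives the i.i.d.
law. The one-sided inequality is enough because, by Kesten's relation, no mass is lost. -/

/-- The walk `ω` stopped at time `t`. -/
def stopAt {d : ℕ} (t : ℕ) (ω : ℕ → Site d) : ℕ → Site d := fun j => ω (min j t)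

/-- The walk `ω` after time `t`, translated to start at `0`. -/
def tailAt {d : ℕ} (t : ℕ) (ω : ℕ → Site d) : ℕ → Site d := fun j => ω (t + j) - ω t

/-- The walk that follows `ω` up to time `t` and then a translate of `η`. -/
def joinAt {d : ℕ} (t : ℕ) (ω η : ℕ → Site d) : ℕ → Site d := fun j => ω (min j t) + η (j - t)

/-- The time reversal of an `n`-step walk, translated to start at `0`. -/
def reversal {d : ℕ} (n : ℕ) (ω : ℕ → Site d) : ℕ → Site d := fun j => ω (n - j) - ω n

/-- The reflection of a walk in the hyperplane where the first coordinate vanishes. -/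
def reflect {d : ℕ} [NeZero d] (ω : ℕ → Site d) : ℕ → Site d :=
  fun j i => if i = 0 then -ω j i else ω j i

/-- The walk `η` preceded by a step in the first coordinate direction. -/
def prepend {d : ℕ} [NeZero d] (η : ℕ → Site d) : ℕ → Site d :=
  fun j => if j = 0 then 0 else Pi.single 0 1 + η (j - 1)

section Operations

variable {d : ℕ} {n t : ℕ} {ω η : ℕ → Site d}

lemma joinAt_stopAt_tailAt (t : ℕ) (ω : ℕ → Site d) : joinAt t (stopAt t ω) (tailAt t ω) = ω := by
  funext j
  simp only [joinAt, stopAt, tailAt]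
  rcases le_total j t with h | h
  · simp [h, Nat.sub_eq_zero_of_le h]
  · simp [h]

lemma eq_of_stopAt_eq_of_tailAt_eq {ω' : ℕ → Site d} (h₁ : stopAt t ω = stopAt t ω')
    (h₂ : tailAt t ω = tailAt t ω') : ω = ω' := by
  rw [← joinAt_stopAt_tailAt t ω, h₁, h₂, joinAt_stopAt_tailAt]

lemma eq_of_forall_le_eq {ω' : ℕ → Site d} (h : ω ∈ selfAvoidingWalks d n)
    (h' : ω' ∈ selfAvoidingWalks d n) (heq : ∀ j ≤ n, ω j = ω' j) : ω = ω' := by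
  funext j
  rcases le_total j n with hj | hj
  · exact heq j hj
  · rw [h.2.2.2 j hj, h'.2.2.2 j hj, heq n le_rfl]

lemma stopAt_mem (h : ω ∈ selfAvoidingWalks d n) (ht : t ≤ n) :
    stopAt t ω ∈ selfAvoidingWalks d t := by
  refine ⟨by simp [stopAt, h.1], fun j hj => ?_, fun j hj k hk e => ?_, fun j hj => ?_⟩
  · simpa [stopAt, min_eq_left hj.le, min_eq_left (Nat.succ_le_of_lt hj)] using
      h.2.1 j (by omega)
  · simp only [stopAt, Set.mem_Iic] at *
    rw [min_eq_left hj, min_eq_left hk] at e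
    exact h.2.2.1 (by simp; omega) (by simp; omega) e
  · simp [stopAt, hj]

lemma tailAt_mem (h : ω ∈ selfAvoidingWalks d n) (ht : t ≤ n) :
    tailAt t ω ∈ selfAvoidingWalks d (n - t) := by
  refine ⟨by simp [tailAt], fun j hj => ?_, fun j hj k hk e => ?_, fun j hj => ?_⟩
  · simpa [tailAt, add_assoc] using h.2.1 (t + j) (by omega)
  · simp only [tailAt, Set.mem_Iic] at *
    have := h.2.2.1 (show t + j ∈ Set.Iic n by simp; omega)
      (show t + k ∈ Set.Iic n by simp; omega) (sub_left_injective e)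
    omega
  · simp only [tailAt]
    rw [h.2.2.2 (t + j) (by omega), show t + (n - t) = n by omega]

lemma reversal_mem (h : ω ∈ selfAvoidingWalks d n) : reversal n ω ∈ selfAvoidingWalks d n := by
  refine ⟨by simp [reversal], fun j hj => ?_, fun j hj k hk e => ?_, fun j hj => ?_⟩
  · have := h.2.1 (n - (j + 1)) (by omega)
    rw [show n - (j + 1) + 1 = n - j by omega] at this
    rw [← this]
    refine Finset.sum_congr rfl fun i _ => ?_
    simp only [reversal, Pi.sub_apply, sub_sub_sub_cancel_right]
    exact abs_sub_comm _ _
  · simp only [reversal, Set.mem_Iic] at *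
    have := h.2.2.1 (show n - j ∈ Set.Iic n by simp) (show n - k ∈ Set.Iic n by simp)
      (sub_left_injective e)
    omega
  · simp [reversal, Nat.sub_eq_zero_of_le hj]

lemma reversal_injOn {ω' : ℕ → Site d} (h : ω ∈ selfAvoidingWalks d n)
    (h' : ω' ∈ selfAvoidingWalks d n) (e : reversal n ω = reversal n ω') : ω = ω' := by
  refine eq_of_forall_le_eq h h' fun j hj => ?_
  have h0 := congrFun e n
  have h1 := congrFun e (n - j)
  simp only [reversal, Nat.sub_self, h.1, h'.1, zero_sub, neg_inj] at h0
  simp only [reversal, h0, Nat.sub_sub_self hj] at h1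
  exact sub_left_injective h1

lemma sum_abs_single (i : Fin d) : ∑ k, |(Pi.single i 1 : Site d) k| = 1 := by
  rw [Finset.sum_eq_single i] <;> simp +contextual

section HalfSpace

variable [NeZero d]

lemma reflect_reflect (ω : ℕ → Site d) : reflect (reflect ω) = ω := by
  funext j i
  by_cases h : i = 0 <;> simp [reflect, h]

lemma reflect_injective : Function.Injective (reflect (d := d)) :=
  Function.LeftInverse.injective reflect_reflect

lemma reflect_apply_eq_iff {j k : ℕ} : reflect ω j = reflect ω k ↔ ω j = ω k := by
  constructor
  · intro h
    funext i
    have := congrFun h i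
    by_cases hi : i = 0
    · subst hi; simpa [reflect] using this
    · simpa [reflect, hi] using this
  · intro h
    funext i
    simp [reflect, h]

lemma reflect_mem (h : ω ∈ selfAvoidingWalks d n) : reflect ω ∈ selfAvoidingWalks d n := by
  refine ⟨?_, fun j hj => ?_, fun j hj k hk e => ?_, fun j hj => ?_⟩
  · funext i; simp [reflect, h.1]
  · rw [← h.2.1 j hj]
    refine Finset.sum_congr rfl fun i _ => ?_
    by_cases hi : i = 0
    · simp only [reflect, hi, if_true]
      rw [← abs_neg]; ring_nf
    · simp [reflect, hi]
  · exact h.2.2.1 hj hk (reflect_apply_eq_iff.1 e)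
  · exact reflect_apply_eq_iff.2 (h.2.2.2 j hj)

@[simp] lemma prepend_zero (η : ℕ → Site d) : prepend η 0 = 0 := rfl

@[simp] lemma prepend_succ (η : ℕ → Site d) (j : ℕ) :
    prepend η (j + 1) = Pi.single 0 1 + η j := by
  simp [prepend]

lemma prepend_injective : Function.Injective (prepend (d := d)) := by
  intro η η' h
  funext j
  simpa using congrFun h (j + 1)

lemma prepend_mem (h : η ∈ selfAvoidingWalks d n) (hη : ∀ j ≤ n, 0 ≤ η j 0) :
    prepend η ∈ halfSpaceWalks d (n + 1) := by
  have hpos : ∀ j ≤ n, 0 < prepend η (j + 1) 0 := fun j hj => by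
    have := hη j hj
    simp; omega
  refine ⟨⟨rfl, fun j hj => ?_, fun j hj k hk e => ?_, fun j hj => ?_⟩, fun j h1 hj => ?_⟩
  · rcases j with _ | j
    · simp [h.1, sum_abs_single]
    · simpa using h.2.1 j (by omega)
  · simp only [Set.mem_Iic] at hj hk
    rcases j with _ | j <;> rcases k with _ | k
    · rfl
    · have := hpos k (by omega)
      rw [← e] at this; simp at this
    · have := hpos j (by omega)
      rw [e] at this; simp at this
    · rw [prepend_succ, prepend_succ] at e
      rw [h.2.2.1 (by simp; omega) (by simp; omega) (add_right_injective _ e)]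
  · obtain ⟨j, rfl⟩ : ∃ i, j = i + 1 := ⟨j - 1, by omega⟩
    rw [prepend_succ, prepend_succ, h.2.2.2 j (by omega)]
  · obtain ⟨j, rfl⟩ : ∃ i, j = i + 1 := ⟨j - 1, by omega⟩
    exact hpos j (by omega)

/-- Joining a bridge and a half-space walk gives a half-space walk. -/
lemma joinAt_mem (h : ω ∈ halfSpaceWalks d t) (hb : IsBridge t ω) (hη : η ∈ halfSpaceWalks d n) :
    joinAt t ω η ∈ halfSpaceWalks d (t + n) := by
  have h0 : ∀ j ≤ t, joinAt t ω η j = ω j := fun j hj => by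
    simp [joinAt, hj, Nat.sub_eq_zero_of_le hj, hη.1.1]
  have h1 : ∀ j, joinAt t ω η (t + j) = ω t + η j := fun j => by simp [joinAt]
  have hle : ∀ j ≤ t, ω j 0 ≤ ω t 0 := fun j hj => by
    rcases Nat.eq_zero_or_pos j with rfl | hj0
    · rcases Nat.eq_zero_or_pos t with rfl | ht0
      · rfl
      · exact (hb t ht0 le_rfl).1.le
    · exact (hb j hj0 hj).2
  have hcases : ∀ j ≤ t + n, j ≤ t ∨ ∃ i, 1 ≤ i ∧ i ≤ n ∧ j = t + i := fun j hj => by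
    rcases le_or_gt j t with h | h
    · exact .inl h
    · exact .inr ⟨j - t, by omega, by omega, by omega⟩
  have hlt : ∀ j i, j ≤ t → 1 ≤ i → i ≤ n → ω j 0 < (ω t + η i) 0 := fun j i hj hi hi' => by
    have := hη.2 i hi hi'
    have := hle j hj
    simp; omega
  refine ⟨⟨by rw [h0 0 (by omega), h.1.1], fun j hj => ?_, fun j hj k hk e => ?_,
    fun j hj => ?_⟩, fun j hj1 hj => ?_⟩
  · rcases lt_or_ge j t with hjt | hjt
    · rw [h0 _ hjt.le, h0 _ hjt]
      exact h.1.2.1 j hjt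
    · obtain ⟨i, rfl⟩ := Nat.exists_eq_add_of_le hjt
      rw [add_assoc, h1, h1]
      simpa using hη.1.2.1 i (by omega)
  · simp only [Set.mem_Iic] at hj hk
    rcases hcases j hj with hj | ⟨i, hi, hi', rfl⟩ <;>
      rcases hcases k hk with hk | ⟨i', hi1, hi1', rfl⟩
    · rw [h0 _ hj, h0 _ hk] at e
      exact h.1.2.2.1 hj hk e
    · rw [h0 _ hj, h1] at e
      have := hlt j i' hj hi1 hi1'
      rw [e] at this; exact absurd this (lt_irrefl _)
    · rw [h0 _ hk, h1] at e
      have := hlt k i hk hi hi'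
      rw [e] at this; exact absurd this (lt_irrefl _)
    · rw [h1, h1] at e
      rw [hη.1.2.2.1 hi' hi1' (add_right_injective _ e)]
  · obtain ⟨i, rfl⟩ := Nat.exists_eq_add_of_le (show t ≤ j by omega)
    rw [h1, h1, hη.1.2.2.2 i (by omega)]
  · rcases hcases j hj with hj | ⟨i, hi, hi', rfl⟩
    · rw [h0 _ hj]; exact h.2 j hj1 hj
    · rw [h1]
      have := hlt 0 i (by omega) hi hi'
      simpa [h.1.1] using this

end HalfSpace

end Operations

/-! ### Hooks -/

/-- The hooks of an `n`-step walk: the times at which it makes a step `v`, then another step, and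
then a step `-v`. -/
def hooks {d : ℕ} (v : Site d) (n : ℕ) (ω : ℕ → Site d) : Finset ℕ :=
  (Finset.range (n - 2)).filter fun j => ω (j + 1) = ω j + v ∧ ω (j + 2) = ω (j + 3) + v

section Hooks

variable {d : ℕ} {v : Site d} {n t : ℕ} {ω η : ℕ → Site d}

lemma mem_hooks {j : ℕ} : j ∈ hooks v n ω ↔
    j + 3 ≤ n ∧ ω (j + 1) = ω j + v ∧ ω (j + 2) = ω (j + 3) + v := by
  simp only [hooks, Finset.mem_filter, Finset.mem_range]
  constructor <;> rintro ⟨h, h'⟩ <;> exact ⟨by omega, h'⟩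

lemma card_hooks_le : (hooks v n ω).card ≤ n :=
  (Finset.card_filter_le _ _).trans (by simp)

/-- Cutting can only destroy hooks, namely those straddling the cut. For `s ≤ 1` this makes the
weight submultiplicative. -/
lemma card_hooks_stopAt_add_tailAt (ht : t ≤ n) :
    (hooks v t (stopAt t ω)).card + (hooks v (n - t) (tailAt t ω)).card ≤ (hooks v n ω).card := by
  rw [← Finset.card_image_of_injective (hooks v (n - t) (tailAt t ω)) (add_right_injective t),
    ← Finset.card_union_of_disjoint]
  · refine Finset.card_le_card fun j hj => ?_
    rcases Finset.mem_union.1 hj with hj | hj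
    · obtain ⟨h1, h2⟩ := mem_hooks.1 hj
      refine mem_hooks.2 ⟨by omega, ?_⟩
      simpa only [stopAt, min_eq_left (show j ≤ t by omega), min_eq_left (show j + 1 ≤ t by omega),
        min_eq_left (show j + 2 ≤ t by omega), min_eq_left h1] using h2
    · obtain ⟨i, hi, rfl⟩ := Finset.mem_image.1 hj
      obtain ⟨h1, h2, h3⟩ := mem_hooks.1 hi
      refine mem_hooks.2 ⟨by omega, ?_, ?_⟩
      · simp only [tailAt] at h2
        rw [← add_assoc] at h2
        linear_combination (exp := 1) h2
      · simp only [tailAt] at h3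
        rw [← add_assoc, ← add_assoc] at h3
        linear_combination (exp := 1) h3
  · rw [Finset.disjoint_left]
    intro j hj hj'
    obtain ⟨i, hi, rfl⟩ := Finset.mem_image.1 hj'
    have := (mem_hooks.1 hj).1
    omega

lemma card_hooks_reversal_le : (hooks v n (reversal n ω)).card ≤ (hooks v n ω).card := by
  refine Finset.card_le_card_of_injOn (fun j => n - 3 - j) (fun j hj => ?_) fun j hj k hk e => ?_
  · obtain ⟨h1, h2, h3⟩ := mem_hooks.1 hj
    simp only [reversal] at h2 h3
    refine mem_hooks.2 ⟨by dsimp only; omega, ?_, ?_⟩ <;> dsimp only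
    · rw [show n - 3 - j + 1 = n - (j + 2) by omega, show n - 3 - j = n - (j + 3) by omega]
      linear_combination (exp := 1) h3
    · rw [show n - 3 - j + 2 = n - (j + 1) by omega, show n - 3 - j + 3 = n - j by omega]
      linear_combination (exp := 1) h2
  · have := (mem_hooks.1 hj).1
    have := (mem_hooks.1 hk).1
    simp only at e
    omega

variable [NeZero d]

lemma hooks_reflect (hv : v 0 = 0) : hooks v n (reflect ω) = hooks v n ω := by
  have key : ∀ j k, reflect ω j = reflect ω k + v ↔ ω j = ω k + v := by
    intro j k
    simp only [funext_iff]
    refine forall_congr' fun i => ?_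
    by_cases hi : i = 0
    · subst hi; simp [reflect, hv]
    · simp [reflect, hi]
  ext j
  simp only [mem_hooks, key]

/-- The new first step changes the first coordinate and `v` does not, so no hook can start with it.
-/
lemma card_hooks_prepend_le (hv : v 0 = 0) (h0 : η 0 = 0) :
    (hooks v (n + 1) (prepend η)).card ≤ (hooks v n η).card := by
  refine Finset.card_le_card_of_injOn (fun j => j - 1) (fun j hj => ?_) fun j hj k hk e => ?_
  all_goals
    have hpos : ∀ j ∈ hooks v (n + 1) (prepend η), 1 ≤ j := fun j hj => by
      by_contra hj0
      obtain rfl : j = 0 := by omega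
      have := congrFun (mem_hooks.1 hj).2.1 0
      simp [h0, hv] at this
  · obtain ⟨i, rfl⟩ : ∃ i, j = i + 1 := ⟨j - 1, by have := hpos j hj; omega⟩
    obtain ⟨h1, h2, h3⟩ := mem_hooks.1 hj
    simp only [prepend_succ, add_assoc] at h2 h3
    exact mem_hooks.2 ⟨by simp; omega, by simpa using h2, by simpa [add_assoc] using h3⟩
  · have := hpos j hj
    have := hpos k hk
    simp only at e
    omega

end Hooks

/-! ### Generating functions -/

/-- The weight `z ^ n * s ^ h` of an `n`-step walk with `h` hooks. -/
noncomputable def weight {d : ℕ} (v : Site d) (s z : ℝ≥0) (p : ℕ × (ℕ → Site d)) : ℝ≥0∞ :=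
  ((z ^ p.1 * s ^ (hooks v p.1 p.2).card : ℝ≥0) : ℝ≥0∞)

/-- The generating function of a set of pairs `(n, ω)`, where `ω` is an `n`-step walk. -/
noncomputable def genFun {d : ℕ} (v : Site d) (s z : ℝ≥0) (X : Set (ℕ × (ℕ → Site d))) : ℝ≥0∞ :=
  ∑' p, X.indicator (weight v s z) p

/-- Self-avoiding walks of all lengths. -/
def walkPairs (d : ℕ) : Set (ℕ × (ℕ → Site d)) := {p | p.2 ∈ selfAvoidingWalks d p.1}

/-- Half-space walks of all lengths. -/
def halfSpacePairs (d : ℕ) [NeZero d] : Set (ℕ × (ℕ → Site d)) := {p | p.2 ∈ halfSpaceWalks d p.1}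

/-- Half-space walks of all lengths with first coordinate at most `k`. -/
def halfSpacePairsBelow (d : ℕ) [NeZero d] (k : ℕ) : Set (ℕ × (ℕ → Site d)) :=
  {p | p ∈ halfSpacePairs d ∧ ∀ j ≤ p.1, p.2 j 0 ≤ k}

/-- Bridges of all lengths. -/
def bridgePairs (d : ℕ) [NeZero d] : Set (ℕ × (ℕ → Site d)) :=
  {p | p ∈ halfSpacePairs d ∧ IsBridge p.1 p.2}

/-- Bridges whose endpoint has first coordinate `k`. -/
def bridgePairsTo (d : ℕ) [NeZero d] (k : ℕ) : Set (ℕ × (ℕ → Site d)) :=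
  {p | p ∈ bridgePairs d ∧ p.2 p.1 0 = k}

/-- Bridges with at most `N` steps. -/
def bridgePairsUpTo (d : ℕ) [NeZero d] (N : ℕ) : Set (ℕ × (ℕ → Site d)) :=
  {p | p ∈ bridgePairs d ∧ p.1 ≤ N}

/-- Irreducible bridges. -/
def irreduciblePairs (d : ℕ) [NeZero d] : Set (ℕ × (ℕ → Site d)) :=
  {p | p ∈ bridgePairs d ∧ 1 ≤ p.1 ∧ ∀ j, ¬ IsRenewalTime p.1 p.2 j}

section GenFun

variable {d : ℕ} {v : Site d} {s z : ℝ≥0} {X Y Y' : Set (ℕ × (ℕ → Site d))}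

lemma genFun_mono (h : X ⊆ Y) : genFun v s z X ≤ genFun v s z Y :=
  ENNReal.tsum_le_tsum fun _ => Set.indicator_le_indicator_of_subset h (fun _ => zero_le) _

lemma genFun_union_le : genFun v s z (X ∪ Y) ≤ genFun v s z X + genFun v s z Y := by
  unfold genFun
  rw [← ENNReal.tsum_add]
  refine ENNReal.tsum_le_tsum fun p => ?_
  by_cases hX : p ∈ X <;> by_cases hY : p ∈ Y <;> simp [hX, hY]

lemma genFun_lt_top (h : X.Finite) : genFun v s z X < ∞ := by
  have := h.to_subtype
  have := Fintype.ofFinite X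
  rw [genFun, ← tsum_subtype, tsum_fintype]
  exact ENNReal.sum_lt_top.2 fun _ _ => ENNReal.coe_lt_top

lemma genFun_le_of_monotone {Z : ℕ → Set (ℕ × (ℕ → Site d))} {M : ℝ≥0∞} (hZ : Monotone Z)
    (hX : ∀ p ∈ X, ∃ k, p ∈ Z k) (hM : ∀ k, genFun v s z (Z k) ≤ M) : genFun v s z X ≤ M := by
  classical
  rw [genFun, ENNReal.tsum_eq_iSup_sum]
  refine iSup_le fun F => ?_
  choose! K hK using hX
  refine le_trans ?_ (hM (F.sup K))
  refine le_trans (Finset.sum_le_sum fun p hp => ?_) (ENNReal.sum_le_tsum F)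
  by_cases h : p ∈ X
  · rw [Set.indicator_of_mem h, Set.indicator_of_mem (hZ (Finset.le_sup hp) (hK p h))]
  · simp [h]

lemma weight_le_mul (hs : s ≤ 1) {n t : ℕ} (ω : ℕ → Site d) (ht : t ≤ n) :
    weight v s z (n, ω) ≤ weight v s z (t, stopAt t ω) * weight v s z (n - t, tailAt t ω) := by
  simp only [weight, ← ENNReal.coe_mul, ENNReal.coe_le_coe]
  calc z ^ n * s ^ (hooks v n ω).card
      ≤ z ^ (t + (n - t)) *
        s ^ ((hooks v t (stopAt t ω)).card + (hooks v (n - t) (tailAt t ω)).card) := by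
        rw [Nat.add_sub_cancel' ht]
        exact mul_le_mul_right (pow_le_pow_of_le_one zero_le hs
          (card_hooks_stopAt_add_tailAt ht)) _
    _ = _ := by ring

/-- Cutting walks in two bounds their generating function by a product. -/
lemma mul_genFun_le_of_cut (hs : s ≤ 1) {φ ψ : ℕ × (ℕ → Site d) → ℕ × (ℕ → Site d)} {c : ℝ≥0∞}
    (hX : X ⊆ walkPairs d) (hφ : Set.InjOn φ (walkPairs d)) (hψ : Set.InjOn ψ (walkPairs d))
    (hφw : ∀ p ∈ walkPairs d, c * weight v s z p ≤ weight v s z (φ p))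
    (hψw : ∀ p ∈ walkPairs d, weight v s z p ≤ weight v s z (ψ p))
    (hcut : ∀ p ∈ X, ∃ t ≤ p.1, φ (t, stopAt t p.2) ∈ Y ∧ ψ (p.1 - t, tailAt t p.2) ∈ Y') :
    c * genFun v s z X ≤ genFun v s z Y * genFun v s z Y' := by
  choose! t ht h1 h2 using hcut
  have hw1 : ∀ p ∈ X, (t p, stopAt (t p) p.2) ∈ walkPairs d := fun p hp =>
    stopAt_mem (hX hp) (ht p hp)
  have hw2 : ∀ p ∈ X, (p.1 - t p, tailAt (t p) p.2) ∈ walkPairs d := fun p hp =>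
    tailAt_mem (hX hp) (ht p hp)
  have hprod : genFun v s z Y * genFun v s z Y' =
      ∑' q : Y × Y', weight v s z q.1 * weight v s z q.2 := by
    simp only [genFun, ← tsum_subtype]
    rw [ENNReal.tsum_prod (f := fun (q : Y) (q' : Y') => weight v s z q * weight v s z q'),
      ← ENNReal.tsum_mul_right]
    exact tsum_congr fun q => ENNReal.tsum_mul_left.symm
  rw [hprod, genFun, ← tsum_subtype, ← ENNReal.tsum_mul_left]
  let f : X → Y × Y' := fun p => (⟨_, h1 p p.2⟩, ⟨_, h2 p p.2⟩)
  -- The lengths of the two pieces add up to the length of the walk, and the pieces glue back to the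
  -- walk itself.
  have hf : Function.Injective f := by
    rintro ⟨p, hp⟩ ⟨q, hq⟩ e
    simp only [f, Prod.mk.injEq, Subtype.mk.injEq] at e
    have e1 := hφ (hw1 p hp) (hw1 q hq) e.1
    have e2 := hψ (hw2 p hp) (hw2 q hq) e.2
    simp only [Prod.mk.injEq] at e1 e2
    have := ht p hp
    have := ht q hq
    refine Subtype.ext (Prod.ext (by dsimp only; omega) ?_)
    obtain ⟨e0, e1⟩ := e1
    rw [e0] at e1 e2
    exact eq_of_stopAt_eq_of_tailAt_eq e1 e2.2
  refine le_trans (ENNReal.tsum_le_tsum fun p => ?_) (ENNReal.tsum_comp_le_tsum_of_injective hf _)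
  calc c * weight v s z p.1
      ≤ c * (weight v s z (t p, stopAt (t p) p.1.2) *
          weight v s z (p.1.1 - t p, tailAt (t p) p.1.2)) :=
        mul_le_mul_right (weight_le_mul hs _ (ht p p.2)) _
    _ ≤ _ := by
        rw [← mul_assoc]
        exact mul_le_mul' (hφw _ (hw1 p p.2)) (hψw _ (hw2 p p.2))

variable [NeZero d]

lemma tailAt_mem_halfSpaceWalks {n t : ℕ} {ω : ℕ → Site d} (h : ω ∈ selfAvoidingWalks d n)
    (ht : t ≤ n) (hpos : ∀ j, t < j → j ≤ n → ω t 0 < ω j 0) :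
    tailAt t ω ∈ halfSpaceWalks d (n - t) :=
  ⟨tailAt_mem h ht, fun j h1 hj => sub_pos.2 (hpos (t + j) (by omega) (by omega))⟩

lemma stopAt_mem_halfSpaceWalks {n t : ℕ} {ω : ℕ → Site d} (h : ω ∈ halfSpaceWalks d n)
    (ht : t ≤ n) : stopAt t ω ∈ halfSpaceWalks d t :=
  ⟨stopAt_mem h.1 ht, fun j h1 hj => by
    simpa [stopAt, hj] using h.2 j h1 (hj.trans ht)⟩

lemma stopAt_isBridge {n t : ℕ} {ω : ℕ → Site d} (h : ω ∈ halfSpaceWalks d n)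
    (ht : t ≤ n) (hmax : ∀ j ≤ t, ω j 0 ≤ ω t 0) : IsBridge t (stopAt t ω) := fun j h1 hj => by
  have := h.2 j h1 (hj.trans ht)
  simpa [stopAt, hj, h.1.1] using ⟨this, hmax j hj⟩

/-! ### Unfolding half-space walks into bridges -/

lemma genFun_halfSpacePairsBelow_zero_le : genFun v s z (halfSpacePairsBelow d 0) ≤ 1 := by
  have hsub : halfSpacePairsBelow d 0 ⊆ {((0 : ℕ), fun _ => 0)} := by
    rintro ⟨n, ω⟩ ⟨h1, h2⟩
    have hn : n = 0 := by
      by_contra hn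
      have h3 := h1.2 n (Nat.pos_of_ne_zero hn) le_rfl
      have h4 := h2 n le_rfl
      dsimp only at h3 h4
      push_cast at h4
      omega
    subst hn
    refine Prod.ext rfl (funext fun j => ?_)
    exact (h1.1.2.2.2 j (Nat.zero_le _)).trans h1.1.1
  refine (genFun_mono hsub).trans ?_
  rw [genFun, ← tsum_subtype, tsum_fintype]
  simp [weight, hooks]

/-- Hammersley–Welsh step. A walk reaching height `k + 1` is a bridge up to its last visit to that
height; the remainder, reflected, is a half-space walk of height at most `k`. -/
lemma genFun_halfSpacePairsBelow_succ_le (hv : v 0 = 0) (hs : s ≤ 1) (k : ℕ) :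
    genFun v s z (halfSpacePairsBelow d (k + 1)) ≤
      genFun v s z (halfSpacePairsBelow d k) * (1 + genFun v s z (bridgePairsTo d (k + 1))) := by
  set Z := {p | p ∈ halfSpacePairsBelow d (k + 1) ∧ ∃ j ≤ p.1, p.2 j 0 = (k + 1 : ℕ)}
  have hsub : halfSpacePairsBelow d (k + 1) ⊆ halfSpacePairsBelow d k ∪ Z := by
    rintro p hp
    by_cases h : ∃ j ≤ p.1, p.2 j 0 = (k + 1 : ℕ)
    · exact .inr ⟨hp, h⟩
    · refine .inl ⟨hp.1, fun j hj => ?_⟩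
      push Not at h
      have h1 := h j hj
      have h2 := hp.2 j hj
      push_cast at h1 h2
      omega
  have hcut : 1 * genFun v s z Z ≤
      genFun v s z (bridgePairsTo d (k + 1)) * genFun v s z (halfSpacePairsBelow d k) := by
    refine mul_genFun_le_of_cut (φ := id) (ψ := fun p => (p.1, reflect p.2)) hs
      (fun p hp => hp.1.1.1) (Set.injOn_id _) ?_ (by simp) ?_ ?_
    · rintro ⟨n, ω⟩ - ⟨n', ω'⟩ - e
      simp only [Prod.mk.injEq] at e
      exact Prod.ext e.1 (reflect_injective e.2)
    · rintro p -
      simp [weight, hooks_reflect hv]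
    · rintro ⟨n, ω⟩ ⟨⟨h, hle⟩, j, hj, hj'⟩
      dsimp only at hj hj' hle ⊢
      have hspec := Nat.findGreatest_spec (P := fun j => ω j 0 = (k + 1 : ℕ)) hj hj'
      -- After the last visit `t` the heights lie in `1, …, k`, so they drop below height `k + 1` by
      -- between `1` and `k`.
      set t := Nat.findGreatest (fun j => ω j 0 = (k + 1 : ℕ)) n with ht
      have htn : t ≤ n := Nat.findGreatest_le n
      have hgt : ∀ j, t < j → j ≤ n → ω j 0 < ω t 0 := fun j h1 h2 => by
        refine lt_of_le_of_ne ?_ fun e => ?_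
        · rw [hspec]; exact hle j h2
        · exact Nat.findGreatest_is_greatest h1 h2 (e.trans hspec)
      refine ⟨t, htn, ⟨⟨stopAt_mem_halfSpaceWalks h htn, stopAt_isBridge h htn fun j hj => ?_⟩,
        ?_⟩, ⟨⟨reflect_mem (tailAt_mem h.1 htn), fun j h1 h2 => ?_⟩, fun j hj => ?_⟩⟩
      · exact (hle j (le_trans hj htn)).trans_eq hspec.symm
      · simpa [stopAt] using hspec
      · have := hgt (t + j) (by omega) (by omega)
        simp [reflect, tailAt, this]
      · dsimp only at hj
        have h4 : 0 < ω (t + j) 0 ∨ t + j = 0 := by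
          rcases Nat.eq_zero_or_pos (t + j) with h0 | h0
          · exact .inr h0
          · exact .inl (h.2 _ h0 (by dsimp only; omega))
        rcases h4 with h4 | h4
        · simp only [reflect, tailAt, if_true, Pi.sub_apply, hspec]
          push_cast
          omega
        · have ht0 : t = 0 := by omega
          have hj0 : j = 0 := by omega
          simp [reflect, tailAt, hj0]
  rw [one_mul] at hcut
  calc _ ≤ _ := (genFun_mono hsub).trans genFun_union_le
    _ ≤ _ := add_le_add_right hcut _
    _ = _ := by ring

lemma sum_genFun_bridgePairsTo_le (K : ℕ) :
    ∑ k ∈ Finset.range K, genFun v s z (bridgePairsTo d (k + 1)) ≤ genFun v s z (bridgePairs d) := by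
  classical
  unfold genFun
  rw [← Summable.tsum_finsetSum fun _ _ => ENNReal.summable]
  refine ENNReal.tsum_le_tsum fun p => ?_
  by_cases h : ∃ k ∈ Finset.range K, p ∈ bridgePairsTo d (k + 1)
  · obtain ⟨k, hk, hp⟩ := h
    rw [Finset.sum_eq_single_of_mem k hk]
    · exact Set.indicator_le_indicator_of_subset (fun _ h => h.1) (fun _ => zero_le) _
    · intro k' _ hne
      refine Set.indicator_of_notMem (fun hp' => hne ?_) _
      have := hp.2.symm.trans hp'.2
      push_cast at this
      omega
  · push Not at h
    rw [Finset.sum_eq_zero fun k hk => Set.indicator_of_notMem (h k hk) _]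
    exact zero_le

/-- Iterating the unfolding bounds the series by ∏ (1 + B_k) ≤ exp (∑ B_k), where B_k is the series
of bridges to height k. -/
lemma genFun_halfSpacePairs_lt_top (hv : v 0 = 0) (hs : s ≤ 1)
    (h : genFun v s z (bridgePairs d) < ∞) : genFun v s z (halfSpacePairs d) < ∞ := by
  have hb : ∀ k, genFun v s z (bridgePairsTo d k) ≠ ∞ := fun k =>
    ((genFun_mono fun _ h => h.1).trans_lt h).ne
  have key : ∀ k, genFun v s z (halfSpacePairsBelow d k) ≤ ENNReal.ofReal (Real.exp
      (∑ i ∈ Finset.range k, genFun v s z (bridgePairsTo d (i + 1))).toReal) := by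
    intro k
    induction k with
    | zero => simpa using genFun_halfSpacePairsBelow_zero_le
    | succ k ih =>
      refine (genFun_halfSpacePairsBelow_succ_le hv hs k).trans ?_
      rw [Finset.sum_range_succ, ENNReal.toReal_add (ENNReal.sum_ne_top.2 fun i _ => hb _) (hb _),
        Real.exp_add, ENNReal.ofReal_mul (Real.exp_nonneg _)]
      refine mul_le_mul' ih ?_
      rw [← ENNReal.ofReal_toReal (hb (k + 1)), ← ENNReal.ofReal_one,
        ← ENNReal.ofReal_add zero_le_one ENNReal.toReal_nonneg,
        ENNReal.toReal_ofReal ENNReal.toReal_nonneg, add_comm]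
      exact ENNReal.ofReal_le_ofReal (Real.add_one_le_exp _)
  refine (genFun_le_of_monotone (Z := halfSpacePairsBelow d)
    (M := ENNReal.ofReal (Real.exp (genFun v s z (bridgePairs d)).toReal)) ?_ ?_ ?_).trans_lt
    ENNReal.ofReal_lt_top
  · intro k l hkl p hp
    exact ⟨hp.1, fun j hj => (hp.2 j hj).trans (by exact_mod_cast hkl)⟩
  · intro p hp
    refine ⟨(Finset.range (p.1 + 1)).sup fun j => (p.2 j 0).toNat, hp, fun j hj => ?_⟩
    have : (p.2 j 0).toNat ≤ _ :=
      Finset.le_sup (f := fun j => (p.2 j 0).toNat) (Finset.mem_range_succ_iff.2 hj)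
    exact (Int.self_le_toNat _).trans (by exact_mod_cast this)
  · intro k
    refine (key k).trans (ENNReal.ofReal_le_ofReal (Real.exp_le_exp.2 ?_))
    exact ENNReal.toReal_mono h.ne (sum_genFun_bridgePairsTo_le k)

/-! ### From half-space walks to all walks -/

lemma exists_last_min (n : ℕ) (f : ℕ → ℤ) :
    ∃ t ≤ n, (∀ j ≤ t, f t ≤ f j) ∧ ∀ j, t < j → j ≤ n → f t < f j := by
  induction n with
  | zero => exact ⟨0, le_rfl, fun j hj => by simp_all, fun j h1 h2 => by omega⟩
  | succ n ih =>
    obtain ⟨t, ht, h1, h2⟩ := ih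
    rcases lt_or_ge (f t) (f (n + 1)) with h | h
    · refine ⟨t, by omega, h1, fun j hj hj' => ?_⟩
      rcases hj'.lt_or_eq with h3 | rfl
      · exact h2 j hj (by omega)
      · exact h
    · refine ⟨n + 1, le_rfl, fun j hj => ?_, fun j h1 h2 => by omega⟩
      rcases le_or_gt j t with h3 | h3
      · exact h.trans (h1 j h3)
      · rcases hj.lt_or_eq with h4 | rfl
        · exact h.trans (h2 j h3 (by omega)).le
        · exact le_rfl

/-- Cut at the last minimum of the first coordinate. The second piece is a half-space walk; the
first, reversed, only stays at nonnegative heights, and one preliminary step makes it a half-space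
walk. That step costs the factor `z`. -/
lemma mul_genFun_walkPairs_le (hv : v 0 = 0) (hs : s ≤ 1) :
    z * genFun v s z (walkPairs d) ≤
      genFun v s z (halfSpacePairs d) * genFun v s z (halfSpacePairs d) := by
  refine mul_genFun_le_of_cut (φ := fun p => (p.1 + 1, prepend (reversal p.1 p.2))) (ψ := id) hs
    subset_rfl ?_ (Set.injOn_id _) ?_ (by simp) ?_
  · rintro ⟨n, ω⟩ hp ⟨n', ω'⟩ hp' e
    simp only [Prod.mk.injEq, add_left_inj] at e
    obtain ⟨rfl, e⟩ := e
    exact Prod.ext rfl (reversal_injOn hp hp' (prepend_injective e))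
  · rintro ⟨n, ω⟩ hp
    simp only [weight, ← ENNReal.coe_mul, ENNReal.coe_le_coe]
    rw [← mul_assoc, ← pow_succ']
    refine mul_le_mul_right (pow_le_pow_of_le_one zero_le hs ?_) _
    exact (card_hooks_prepend_le hv (by simp [reversal])).trans card_hooks_reversal_le
  · rintro ⟨n, ω⟩ h
    obtain ⟨t, ht, h1, h2⟩ := exists_last_min n fun j => ω j 0
    refine ⟨t, ht, prepend_mem (reversal_mem (stopAt_mem h ht)) fun j hj => ?_,
      tailAt_mem_halfSpaceWalks h ht h2⟩
    simpa [reversal, stopAt] using h1 _ (by omega)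

/-- Cutting a nontrivial bridge at its first renewal time leaves an irreducible bridge and a bridge.
The length is truncated at `N` to have finite series, so that the renewal inequality can be solved
for them. -/
lemma genFun_bridgePairsUpTo_le (hs : s ≤ 1) (N : ℕ) :
    genFun v s z (bridgePairsUpTo d N) ≤
      1 + genFun v s z (irreduciblePairs d) * genFun v s z (bridgePairsUpTo d N) := by
  have hsub : bridgePairsUpTo d N ⊆
      halfSpacePairsBelow d 0 ∪ {p | p ∈ bridgePairsUpTo d N ∧ 1 ≤ p.1} := by
    intro p hp
    rcases Nat.eq_zero_or_pos p.1 with h | h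
    · refine .inl ⟨hp.1.1, fun j hj => ?_⟩
      obtain rfl : j = 0 := by omega
      simp [hp.1.1.1.1]
    · exact .inr ⟨hp, h⟩
  refine (genFun_mono hsub).trans (genFun_union_le.trans
    (add_le_add genFun_halfSpacePairsBelow_zero_le ?_))
  rw [← one_mul (genFun v s z {p | _})]
  refine mul_genFun_le_of_cut (φ := id) (ψ := id) hs (fun p hp => hp.1.1.1.1) (Set.injOn_id _)
    (Set.injOn_id _) (by simp) (by simp) ?_
  rintro ⟨n, ω⟩ ⟨⟨⟨h, hb⟩, hN⟩, hn⟩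
  dsimp only [id] at *
  have hmax : ∀ k ≤ n, ω k 0 ≤ ω n 0 := fun k hk => by
    rcases Nat.eq_zero_or_pos k with rfl | hk0
    · exact (hb n hn le_rfl).1.le
    · exact (hb k hk0 hk).2
  -- Unlike a renewal time, `t = n` is allowed, where the condition is vacuous; it is the cut point
  -- when the bridge is irreducible.
  have hex : ∃ t, 1 ≤ t ∧ t ≤ n ∧ ∀ k m, k ≤ t → t < m → m ≤ n → ω k 0 ≤ ω t 0 ∧ ω t 0 < ω m 0 :=
    ⟨n, hn, le_rfl, fun k m _ h1 h2 => by omega⟩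
  classical
  obtain ⟨ht1, htn, ht⟩ := Nat.find_spec hex
  have hmin := fun m => Nat.find_min hex (m := m)
  set t := Nat.find hex
  have hle : ∀ k ≤ t, ω k 0 ≤ ω t 0 := fun k hk => by
    rcases htn.lt_or_eq with h' | h'
    · exact (ht k n hk h' le_rfl).1
    · rw [h'] at hk ⊢; exact hmax k hk
  refine ⟨t, htn, ⟨⟨stopAt_mem_halfSpaceWalks h htn, stopAt_isBridge h htn hle⟩, ht1, ?_⟩,
    ⟨⟨tailAt_mem_halfSpaceWalks h.1 htn fun j h1 h2 => (ht 0 j (by omega) h1 h2).2,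
      fun j h1 h2 => ?_⟩, ?_⟩⟩
  · rintro j ⟨hj1, hj2, hj⟩
    dsimp only at hj2 hj
    refine hmin j hj2 ⟨hj1, by omega, fun k m hk hm hmn => ?_⟩
    have e : ∀ i ≤ t, stopAt t ω i = ω i := fun i hi => by simp [stopAt, hi]
    have h1 : ∀ k ≤ j, ω k 0 ≤ ω j 0 := fun k hk => by
      have := (hj k t hk hj2 le_rfl).1
      rwa [e k (by omega), e j (by omega)] at this
    refine ⟨h1 k hk, ?_⟩
    rcases le_or_gt m t with hmt | hmt
    · have := (hj k m hk hm hmt).2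
      rwa [e m (by omega), e j (by omega)] at this
    · exact (hle j hj2.le).trans_lt (ht 0 m (by omega) hmt hmn).2
  · dsimp only at h1 h2
    have h3 := (ht 0 (t + j) (by omega) (by omega) (by omega)).2
    have h4 := hmax (t + j) (by omega)
    simp only [tailAt, add_zero, sub_self, Pi.sub_apply,
      show t + (n - t) = n by omega]
    constructor <;> omega
  · dsimp only; omega

lemma bridgePairsUpTo_finite (N : ℕ) : (bridgePairsUpTo d N).Finite := by
  refine Set.Finite.subset (s := ⋃ n ∈ Finset.range (N + 1), Prod.mk n '' halfSpaceWalks d n)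
    (Set.Finite.biUnion (Finset.finite_toSet _) fun n _ => (halfSpaceWalks_finite d n).image _) ?_
  rintro ⟨n, ω⟩ hp
  simp only [Set.mem_iUnion]
  exact ⟨n, Finset.mem_range_succ_iff.2 hp.2, ω, hp.1.1, rfl⟩

lemma genFun_bridgePairs_lt_top (hs : s ≤ 1) (h : genFun v s z (irreduciblePairs d) < 1) :
    genFun v s z (bridgePairs d) < ∞ := by
  set I := genFun v s z (irreduciblePairs d)
  refine (genFun_le_of_monotone (Z := bridgePairsUpTo d) (M := (1 - I)⁻¹) ?_ ?_ ?_).trans_lt ?_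
  · exact fun k l hkl p hp => ⟨hp.1, hp.2.trans hkl⟩
  · exact fun p hp => ⟨p.1, hp, le_rfl⟩
  · intro N
    have h1 := genFun_bridgePairsUpTo_le (d := d) (v := v) (z := z) hs N
    have h2 : genFun v s z (bridgePairsUpTo d N) ≠ ∞ := (genFun_lt_top (bridgePairsUpTo_finite N)).ne
    set g := genFun v s z (bridgePairsUpTo d N)
    rw [ENNReal.le_inv_iff_mul_le, mul_comm, ENNReal.sub_mul fun _ _ => h2, one_mul,
      tsub_le_iff_right]
    exact h1
  · exact ENNReal.inv_lt_top.2 (tsub_pos_of_lt h)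

/-- If the generating function of irreducible bridges is less than `1`, then that of all
self-avoiding walks is finite. -/
lemma genFun_walkPairs_lt_top (hv : v 0 = 0) (hs : s ≤ 1) (hz : z ≠ 0)
    (h : genFun v s z (irreduciblePairs d) < 1) : genFun v s z (walkPairs d) < ∞ := by
  have h1 := genFun_halfSpacePairs_lt_top hv hs (genFun_bridgePairs_lt_top hs h)
  have h2 := (mul_genFun_walkPairs_le (z := z) hv hs).trans_lt (ENNReal.mul_lt_top h1 h1)
  by_contra h3
  rw [not_lt, top_le_iff] at h3
  rw [h3, ENNReal.mul_top (by simpa using hz)] at h2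
  exact lt_irrefl _ h2

end GenFun

/-! ### Exponential growth rates -/

/-- The partition function of `n`-step self-avoiding walks, with weight `s` for each hook. -/
noncomputable def partitionFunction {d : ℕ} (v : Site d) (s : ℝ≥0) (n : ℕ) : ℝ≥0 :=
  ∑ ω ∈ (selfAvoidingWalks_finite d n).toFinset, s ^ (hooks v n ω).card

section PartitionFunction

variable {d : ℕ} {v : Site d} {s : ℝ≥0}

lemma partitionFunction_add_le (hs : s ≤ 1) (m n : ℕ) :
    partitionFunction v s (m + n) ≤ partitionFunction v s m * partitionFunction v s n := by
  classical
  unfold partitionFunction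
  rw [Finset.sum_mul_sum, ← Finset.sum_product']
  have hinj : Set.InjOn (fun ω : ℕ → Site d => (stopAt m ω, tailAt m ω))
      (selfAvoidingWalks_finite d (m + n)).toFinset := fun ω _ ω' _ e => by
    simp only [Prod.mk.injEq] at e
    exact eq_of_stopAt_eq_of_tailAt_eq e.1 e.2
  calc _ ≤ ∑ ω ∈ (selfAvoidingWalks_finite d (m + n)).toFinset,
        s ^ (hooks v m (stopAt m ω)).card * s ^ (hooks v n (tailAt m ω)).card := by
        refine Finset.sum_le_sum fun ω _ => ?_
        rw [← pow_add]
        refine pow_le_pow_of_le_one zero_le hs ?_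
        simpa using card_hooks_stopAt_add_tailAt (v := v) (ω := ω) (Nat.le_add_right m n)
    _ = ∑ q ∈ (selfAvoidingWalks_finite d (m + n)).toFinset.image
          (fun ω => (stopAt m ω, tailAt m ω)),
        s ^ (hooks v m q.1).card * s ^ (hooks v n q.2).card := 
        (Finset.sum_image (f := fun q : (ℕ → Site d) × (ℕ → Site d) =>
          s ^ (hooks v m q.1).card * s ^ (hooks v n q.2).card) hinj).symm
    _ ≤ _ := by
        refine Finset.sum_le_sum_of_subset fun q hq => ?_
        obtain ⟨ω, hω, rfl⟩ := Finset.mem_image.1 hq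
        rw [Set.Finite.mem_toFinset] at hω
        simp only [Finset.mem_product, Set.Finite.mem_toFinset]
        exact ⟨stopAt_mem hω (by omega), by simpa using tailAt_mem hω (Nat.le_add_right m n)⟩

lemma partitionFunction_one (v : Site d) (n : ℕ) : partitionFunction v 1 n = sawCount d n := by
  simp [partitionFunction, sawCount, Set.ncard_eq_toFinset_card _ (selfAvoidingWalks_finite d n)]

lemma partitionFunction_mono {s' : ℝ≥0} (h : s ≤ s') (n : ℕ) :
    partitionFunction v s n ≤ partitionFunction v s' n :=
  Finset.sum_le_sum fun _ _ => pow_le_pow_left₀ zero_le h _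

/-- Each length contributes at least 1 to the series. -/
lemma genFun_walkPairs_eq_top {z : ℝ≥0} (h : ∀ n, 1 ≤ z ^ n * partitionFunction v s n) :
    genFun v s z (walkPairs d) = ∞ := by
  rw [← top_le_iff, ← ENNReal.tsum_const_eq_top_of_ne_zero (α := ℕ) one_ne_zero, genFun,
    ENNReal.tsum_prod']
  refine ENNReal.tsum_le_tsum fun n => ?_
  refine le_trans ?_ (ENNReal.sum_le_tsum (selfAvoidingWalks_finite d n).toFinset)
  have h1 : ∑ ω ∈ (selfAvoidingWalks_finite d n).toFinset,
      (walkPairs d).indicator (weight v s z) (n, ω) =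
      ((z ^ n * partitionFunction v s n : ℝ≥0) : ℝ≥0∞) := by
    rw [partitionFunction, Finset.mul_sum, ENNReal.ofNNReal_finsetSum]
    refine Finset.sum_congr rfl fun ω hω => ?_
    have hmem : (n, ω) ∈ walkPairs d := by simpa [walkPairs] using hω
    rw [Set.indicator_of_mem hmem]
    rfl
  rw [h1]
  exact_mod_cast h n

variable [NeZero d]

lemma pow_le_partitionFunction (hs : s ≤ 1) (n : ℕ) : s ^ n ≤ partitionFunction v s n := by
  obtain ⟨ω, hω⟩ := halfSpaceWalks_nonempty d n
  refine (pow_le_pow_of_le_one zero_le hs (card_hooks_le (v := v) (ω := ω))).trans ?_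
  exact Finset.single_le_sum (f := fun ω => s ^ (hooks v n ω).card) (fun _ _ => zero_le)
    ((Set.Finite.mem_toFinset _).2 hω.1)

lemma partitionFunction_pos (hs0 : 0 < s) (hs : s ≤ 1) (n : ℕ) : 0 < partitionFunction v s n :=
  (pow_pos hs0 n).trans_le (pow_le_partitionFunction hs n)

/-- Fekete's lemma. The limit of a subadditive sequence divided by `n` is its infimum, which gives
the lower bound for every single `n`. -/
lemma exists_tendsto_log_partitionFunction (hs0 : 0 < s) (hs : s ≤ 1) (v : Site d) :
    ∃ l : ℝ, Tendsto (fun n : ℕ => Real.log (partitionFunction v s n) / n) atTop (𝓝 l) ∧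
      ∀ n : ℕ, Real.exp l ^ n ≤ partitionFunction v s n := by
  have hpos : ∀ n, 0 < (partitionFunction v s n : ℝ) := fun n => partitionFunction_pos hs0 hs n
  have hsub : Subadditive fun n => Real.log (partitionFunction v s n) := fun m n => by
    rw [← Real.log_mul (hpos m).ne' (hpos n).ne']
    exact Real.log_le_log (hpos _) (by exact_mod_cast partitionFunction_add_le hs m n)
  have hbdd : BddBelow (Set.range fun n : ℕ => Real.log (partitionFunction v s n) / n) := by
    refine ⟨Real.log s, ?_⟩
    rintro _ ⟨n, rfl⟩
    rcases Nat.eq_zero_or_pos n with rfl | hn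
    · simpa using Real.log_nonpos s.2 (by exact_mod_cast hs)
    · rw [le_div_iff₀ (by exact_mod_cast hn), mul_comm, ← Real.log_pow]
      exact Real.log_le_log (by positivity) (by exact_mod_cast pow_le_partitionFunction hs n)
  refine ⟨hsub.lim, hsub.tendsto_lim hbdd, fun n => ?_⟩
  rcases Nat.eq_zero_or_pos n with rfl | hn
  · have := pow_le_partitionFunction (v := v) hs 0
    rw [pow_zero] at this ⊢
    exact_mod_cast this
  · rw [← Real.exp_nat_mul, ← Real.le_log_iff_exp_le (hpos n), mul_comm,
      ← le_div_iff₀ (by exact_mod_cast hn)]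
    exact hsub.lim_le_div hbdd hn.ne'

/-- The generating function of irreducible bridges is at least `1` at the radius of convergence of
that of all self-avoiding walks. -/
lemma one_le_genFun_irreduciblePairs (hv : v 0 = 0) (hs : s ≤ 1) {l : ℝ}
    (h : ∀ n : ℕ, Real.exp l ^ n ≤ partitionFunction v s n) :
    1 ≤ genFun v s (Real.exp l).toNNReal⁻¹ (irreduciblePairs d) := by
  have hpos : 0 < (Real.exp l).toNNReal := Real.toNNReal_pos.2 (Real.exp_pos l)
  by_contra hlt
  refine (genFun_walkPairs_lt_top hv hs (inv_ne_zero hpos.ne') (not_le.1 hlt)).ne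
    (genFun_walkPairs_eq_top fun n => ?_)
  rw [inv_pow, ← div_eq_inv_mul, one_le_div (pow_pos hpos n), ← NNReal.coe_le_coe]
  simpa [Real.coe_toNNReal _ (Real.exp_nonneg l)] using h n

end PartitionFunction

/-! ### Irreducible bridges -/

section Irreducible

variable {d : ℕ} [NeZero d]

lemma irreducibleBridge_ext {b b' : IrreducibleBridge d} (h : b.length = b'.length)
    (h' : b.path = b'.path) : b = b' := by
  cases b; cases b'; cases h; cases h'; rfl

lemma genFun_irreduciblePairs (v : Site d) (s z : ℝ≥0) :
    genFun v s z (irreduciblePairs d) =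
      ∑' b : IrreducibleBridge d, weight v s z (b.length, b.path) := by
  have hinj : Function.Injective fun b : IrreducibleBridge d => (b.length, b.path) := by
    intro b b' e
    simp only [Prod.mk.injEq] at e
    exact irreducibleBridge_ext e.1 e.2
  have hrange : irreduciblePairs d = Set.range fun b : IrreducibleBridge d => (b.length, b.path) := by
    ext p
    constructor
    · rintro ⟨⟨h1, h2⟩, h3, h4⟩
      exact ⟨⟨p.1, p.2, h3, h1, h2, h4⟩, rfl⟩
    · rintro ⟨b, rfl⟩
      exact ⟨⟨b.path_mem, b.isBridge⟩, b.length_pos, b.irreducible⟩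
  rw [genFun, ← tsum_subtype, hrange, tsum_range _ hinj]

instance : Countable (IrreducibleBridge d) := by
  have (n : ℕ) : Countable (halfSpaceWalks d n) := (halfSpaceWalks_finite d n).countable.to_subtype
  refine Function.Injective.countable
    (f := fun b : IrreducibleBridge d => (⟨b.length, b.path, b.path_mem⟩ : Σ n, halfSpaceWalks d n))
    fun b b' e => ?_
  obtain ⟨n, ω, h1, h2, h3, h4⟩ := b
  obtain ⟨n', ω', h1', h2', h3', h4'⟩ := b'
  simp only [Sigma.mk.injEq] at e
  obtain ⟨rfl, e⟩ := e
  simp only [heq_eq_eq, Subtype.mk.injEq] at e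
  subst e
  rfl

/-- The set of `n`-step half-space walks, as a finite set. -/
noncomputable def halfSpaceFinset (d n : ℕ) [NeZero d] : Finset (ℕ → Site d) :=
  (halfSpaceWalks_finite d n).toFinset

@[simp] lemma mem_halfSpaceFinset {n : ℕ} {ω : ℕ → Site d} :
    ω ∈ halfSpaceFinset d n ↔ ω ∈ halfSpaceWalks d n := Set.Finite.mem_toFinset _

lemma card_halfSpaceFinset (d n : ℕ) [NeZero d] :
    (halfSpaceFinset d n).card = halfSpaceCount d n :=
  (Set.ncard_eq_toFinset_card _ (halfSpaceWalks_finite d n)).symm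

lemma halfSpaceCount_pos (d n : ℕ) [NeZero d] : 0 < halfSpaceCount d n :=
  (Set.ncard_pos (halfSpaceWalks_finite d n)).2 (halfSpaceWalks_nonempty d n)

lemma halfSpaceCount_le_sawCount (n : ℕ) : halfSpaceCount d n ≤ sawCount d n :=
  Set.ncard_le_ncard (fun _ h => h.1) (selfAvoidingWalks_finite d n)

/-- The first irreducible bridge of a half-space walk is determined by the walk. -/
lemma joinAt_injective {n : ℕ} {b b' : IrreducibleBridge d} {η η' : ℕ → Site d}
    (hb : b.length ≤ n) (hb' : b'.length ≤ n) (hη : η ∈ halfSpaceWalks d (n - b.length))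
    (hη' : η' ∈ halfSpaceWalks d (n - b'.length))
    (e : joinAt b.length b.path η = joinAt b'.length b'.path η') : b = b' ∧ η = η' := by
  wlog hle : b.length ≤ b'.length generalizing b b' η η'
  · obtain ⟨h1, h2⟩ := this hb' hb hη' hη e.symm (by omega)
    exact ⟨h1.symm, h2.symm⟩
  have hpre : ∀ (b : IrreducibleBridge d) (m : ℕ) (η : ℕ → Site d), η ∈ halfSpaceWalks d m →
      ∀ j ≤ b.length, joinAt b.length b.path η j = b.path j := fun b m η hη j hj => by
    simp [joinAt, hj, Nat.sub_eq_zero_of_le hj, hη.1.1]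
  have hlen : b.length = b'.length := by
    by_contra hne
    -- If the lengths differed, the end of the shorter bridge would be a renewal time of the longer
    -- one: both follow the common walk, which stays strictly above that level afterwards.
    refine b'.irreducible b.length ⟨b.length_pos, by omega, fun k m hk hm hm' => ?_⟩
    rw [← hpre b' _ η' hη' k (by omega), ← hpre b' _ η' hη' _ hle, ← hpre b' _ η' hη' m hm', ← e,
      hpre b _ η hη k hk, hpre b _ η hη _ le_rfl]
    constructor
    · rcases Nat.eq_zero_or_pos k with rfl | hk0
      · exact (b.isBridge _ b.length_pos le_rfl).1.le
      · exact (b.isBridge k hk0 hk).2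
    · simpa [joinAt, hm.le] using hη.2 (m - b.length) (by omega) (by omega)
  have hpath : b.path = b'.path :=
    eq_of_forall_le_eq b.path_mem.1 (hlen ▸ b'.path_mem.1) fun j hj => by
      rw [← hpre b _ η hη j hj, e, hpre b' _ η' hη' j (by omega)]
  refine ⟨irreducibleBridge_ext hlen hpath, funext fun j => ?_⟩
  have := congrFun e (b.length + j)
  rw [← hlen, ← hpath] at this
  simpa [joinAt] using this

open Classical in
/-- Half-space walks that start with an irreducible bridge are counted by the shorter walks that
follow it. -/
lemma sum_card_filter_le (T : Finset (IrreducibleBridge d)) (G : Set (ℕ → Site d)) (n : ℕ)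
    (hT : ∀ b ∈ T, b.length ≤ n) :
    ∑ b ∈ T, ((halfSpaceFinset d (n - b.length)).filter
      fun η => joinAt b.length b.path η ∈ G).card ≤ ((halfSpaceFinset d n).filter (· ∈ G)).card := by
  have hcard : ∀ b ∈ T, ((halfSpaceFinset d (n - b.length)).filter
      fun η => joinAt b.length b.path η ∈ G).card =
      (((halfSpaceFinset d (n - b.length)).filter
      fun η => joinAt b.length b.path η ∈ G).image (joinAt b.length b.path)).card := by
    intro b hb
    refine (Finset.card_image_of_injOn fun η hη η' hη' e => ?_).symm
    simp only [Finset.coe_filter, mem_halfSpaceFinset, Set.mem_ofPred_eq] at hη hη'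
    exact (joinAt_injective (hT b hb) (hT b hb) hη.1 hη'.1 e).2
  rw [Finset.sum_congr rfl hcard, ← Finset.card_biUnion]
  · refine Finset.card_le_card fun ω hω => ?_
    simp only [Finset.mem_biUnion, Finset.mem_image, Finset.mem_filter, mem_halfSpaceFinset] at hω
    obtain ⟨b, hb, η, ⟨h1, h2⟩, rfl⟩ := hω
    refine Finset.mem_filter.2 ⟨mem_halfSpaceFinset.2 ?_, h2⟩
    have := joinAt_mem b.path_mem b.isBridge h1
    rwa [Nat.add_sub_cancel' (hT b hb)] at this
  · intro b hb b' hb' hne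
    rw [Function.onFun, Finset.disjoint_left]
    intro ω hω hω'
    simp only [Finset.mem_image, Finset.mem_filter, mem_halfSpaceFinset] at hω hω'
    obtain ⟨η, ⟨h1, -⟩, rfl⟩ := hω
    obtain ⟨η', ⟨h1', -⟩, e⟩ := hω'
    exact hne (joinAt_injective (hT b hb) (hT b' hb') h1 h1' e.symm).1

lemma sum_halfSpaceCount_le (T : Finset (IrreducibleBridge d)) (n : ℕ)
    (hT : ∀ b ∈ T, b.length ≤ n) :
    ∑ b ∈ T, halfSpaceCount d (n - b.length) ≤ halfSpaceCount d n := by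
  have := sum_card_filter_le T Set.univ n hT
  simpa [card_halfSpaceFinset] using this

/-- Strong induction on the renewal inequality u_n ≥ ∑ u_(n-|b|), which propagates the bound as soon
as the weights sum to at least 1. -/
lemma exists_mul_pow_le_halfSpaceCount (T : Finset (IrreducibleBridge d)) {ρ : ℝ} (hρ : 0 < ρ)
    (hT : 1 ≤ ∑ b ∈ T, (ρ ^ b.length)⁻¹) :
    ∃ c > 0, ∀ n, c * ρ ^ n ≤ halfSpaceCount d n := by
  set m := T.sup IrreducibleBridge.length
  have hm : ∀ b ∈ T, b.length ≤ m := fun b hb => Finset.le_sup (f := IrreducibleBridge.length) hb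
  -- The constant makes the left side at most 1 for all `n ≤ m`, the lengths not covered by the
  -- recursion.
  refine ⟨((1 + ρ) ^ m)⁻¹, by positivity, fun n => ?_⟩
  induction n using Nat.strong_induction_on with
  | _ n ih =>
    rcases le_or_gt n m with h | h
    · have h1 : ρ ^ n ≤ (1 + ρ) ^ m :=
        (pow_le_pow_left₀ hρ.le (by linarith) n).trans (pow_le_pow_right₀ (by linarith) h)
      calc _ ≤ ((1 + ρ) ^ m)⁻¹ * (1 + ρ) ^ m := by gcongr
        _ = 1 := inv_mul_cancel₀ (by positivity)
        _ ≤ _ := by exact_mod_cast halfSpaceCount_pos d n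
    · have hT' : ∀ b ∈ T, b.length ≤ n := fun b hb => (hm b hb).trans h.le
      calc ((1 + ρ) ^ m)⁻¹ * ρ ^ n = ((1 + ρ) ^ m)⁻¹ * ρ ^ n * 1 := by ring
        _ ≤ ((1 + ρ) ^ m)⁻¹ * ρ ^ n * ∑ b ∈ T, (ρ ^ b.length)⁻¹ := by gcongr
        _ = ∑ b ∈ T, ((1 + ρ) ^ m)⁻¹ * ρ ^ (n - b.length) := by
          rw [Finset.mul_sum]
          refine Finset.sum_congr rfl fun b hb => ?_
          rw [pow_sub₀ _ hρ.ne' (hT' b hb)]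
          ring
        _ ≤ ∑ b ∈ T, (halfSpaceCount d (n - b.length) : ℝ) :=
          Finset.sum_le_sum fun b hb => ih _ (by have := b.length_pos; omega)
        _ ≤ _ := by exact_mod_cast sum_halfSpaceCount_le T n hT'

end Irreducible

/-! ### The connective constant and Kesten's relation -/

lemma weight_one_eq {d : ℕ} (v : Site d) {β : ℝ} (hβ : 0 < β) (p : ℕ × (ℕ → Site d)) :
    weight v 1 β.toNNReal⁻¹ p = ENNReal.ofReal (β ^ p.1)⁻¹ := by
  rw [weight, one_pow, mul_one, inv_pow, ← Real.toNNReal_pow hβ.le, ← Real.toNNReal_inv]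
  rfl

section Connective

variable {d : ℕ} [NeZero d]

lemma sawCount_pos (d n : ℕ) [NeZero d] : 0 < sawCount d n :=
  (halfSpaceCount_pos d n).trans_le (halfSpaceCount_le_sawCount n)

lemma exists_tendsto_sawCount (d : ℕ) [NeZero d] :
    Tendsto (fun n : ℕ => (sawCount d n : ℝ) ^ (1 / (n : ℝ))) atTop (𝓝 (connectiveConstant d)) ∧
    0 < connectiveConstant d ∧
    Tendsto (fun n : ℕ => Real.log (sawCount d n) / n) atTop (𝓝 (Real.log (connectiveConstant d))) ∧
    ∀ n : ℕ, connectiveConstant d ^ n ≤ sawCount d n := by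
  obtain ⟨l, h1, h2⟩ := exists_tendsto_log_partitionFunction one_pos le_rfl (0 : Site d)
  simp only [partitionFunction_one, NNReal.coe_natCast] at h1 h2
  have h3 : Tendsto (fun n : ℕ => (sawCount d n : ℝ) ^ (1 / (n : ℝ))) atTop (𝓝 (Real.exp l)) := by
    refine ((Real.continuous_exp.tendsto l).comp h1).congr fun n => ?_
    rw [Real.rpow_def_of_pos (by exact_mod_cast sawCount_pos d n), Function.comp_apply, mul_one_div]
  have h4 : connectiveConstant d = Real.exp l := h3.limUnder_eq
  rw [h4, Real.log_exp]
  exact ⟨h3, Real.exp_pos l, h1, h2⟩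

lemma connectiveConstant_pos (d : ℕ) [NeZero d] : 0 < connectiveConstant d :=
  (exists_tendsto_sawCount d).2.1

lemma log_le_of_mul_pow_le {a : ℕ → ℝ} {l c ρ : ℝ}
    (hl : Tendsto (fun n : ℕ => Real.log (a n) / n) atTop (𝓝 l)) (hc : 0 < c) (hρ : 0 < ρ)
    (h : ∀ n, c * ρ ^ n ≤ a n) : Real.log ρ ≤ l := by
  have h1 : Tendsto (fun n : ℕ => Real.log c / n + Real.log ρ) atTop (𝓝 (0 + Real.log ρ)) :=
    (tendsto_const_div_atTop_nhds_zero_nat _).add_const _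
  rw [zero_add] at h1
  refine le_of_tendsto_of_tendsto h1 hl ?_
  filter_upwards [eventually_gt_atTop 0] with n hn
  have hn' : (0 : ℝ) < n := by exact_mod_cast hn
  rw [div_add' _ _ _ hn'.ne', div_le_div_iff_of_pos_right hn', mul_comm (Real.log ρ),
    ← Real.log_pow, ← Real.log_mul hc.ne' (by positivity)]
  exact Real.log_le_log (by positivity) (h n)

/-- By continuity a finite sum above 1 stays above 1 at some `ρ` greater than the connective
constant, and the walks would then grow at rate at least `ρ`. -/
lemma sum_inv_pow_le_one (T : Finset (IrreducibleBridge d)) :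
    ∑ b ∈ T, (connectiveConstant d ^ b.length)⁻¹ ≤ 1 := by
  by_contra! hlt
  have hβ := connectiveConstant_pos d
  have hcont : ContinuousAt (fun ρ : ℝ => ∑ b ∈ T, (ρ ^ b.length)⁻¹) (connectiveConstant d) :=
    tendsto_finsetSum _ fun b _ => (continuousAt_id.pow _).inv₀ (pow_pos hβ _).ne'
  obtain ⟨ρ, h1, h2⟩ := ((frequently_gt_nhds (connectiveConstant d)).and_eventually
    (hcont.eventually_const_lt hlt)).exists
  obtain ⟨c, hc, h⟩ := exists_mul_pow_le_halfSpaceCount T (hβ.trans h1) h2.le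
  have h3 := log_le_of_mul_pow_le (a := fun n => (sawCount d n : ℝ))
    (exists_tendsto_sawCount d).2.2.1 hc (hβ.trans h1)
    fun n => (h n).trans (by exact_mod_cast halfSpaceCount_le_sawCount n)
  exact absurd (Real.log_lt_log hβ h1) (not_lt.2 h3)

lemma tsum_inv_pow_le_one :
    ∑' b : IrreducibleBridge d, ENNReal.ofReal (connectiveConstant d ^ b.length)⁻¹ ≤ 1 := by
  have hβ := connectiveConstant_pos d
  rw [ENNReal.tsum_eq_iSup_sum]
  refine iSup_le fun T => ?_
  rw [← ENNReal.ofReal_sum_of_nonneg fun b _ => by positivity]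
  exact ENNReal.ofReal_le_one.2 (sum_inv_pow_le_one T)

/-- **Kesten's relation**: the weights `β ^ (-k)` of irreducible bridges sum to `1`. -/
lemma tsum_inv_pow_eq_one (d : ℕ) [NeZero d] :
    ∑' b : IrreducibleBridge d, ENNReal.ofReal (connectiveConstant d ^ b.length)⁻¹ = 1 := by
  have hβ := connectiveConstant_pos d
  refine le_antisymm tsum_inv_pow_le_one ?_
  -- With weight `s = 1` hooks play no role, so `v = 0` will do.
  have := one_le_genFun_irreduciblePairs (v := (0 : Site d)) rfl le_rfl
    (l := Real.log (connectiveConstant d)) fun n => by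
      rw [Real.exp_log hβ, partitionFunction_one]
      exact_mod_cast (exists_tendsto_sawCount d).2.2.2 n
  rw [Real.exp_log hβ, genFun_irreduciblePairs] at this
  simpa only [weight_one_eq _ hβ] using this

lemma exists_finset_lt_sum_inv_pow {x : ℝ} (hx : x < 1) : ∃ T : Finset (IrreducibleBridge d),
    x < ∑ b ∈ T, (connectiveConstant d ^ b.length)⁻¹ := by
  have hβ := connectiveConstant_pos d
  have h1 : ENNReal.ofReal x < 1 := ENNReal.ofReal_lt_one.2 hx
  rw [← tsum_inv_pow_eq_one d, ENNReal.tsum_eq_iSup_sum] at h1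
  obtain ⟨T, hT⟩ := lt_iSup_iff.1 h1
  rw [← ENNReal.ofReal_sum_of_nonneg fun b _ => by positivity] at hT
  exact ⟨T, (ENNReal.ofReal_lt_ofReal_iff'.1 hT).1⟩

/-- Restricting to half-space walks does not change the growth rate: by Kesten's relation, for any
smaller rate finitely many irreducible bridges already have total weight above 1. -/
lemma tendsto_log_halfSpaceCount (d : ℕ) [NeZero d] :
    Tendsto (fun n : ℕ => Real.log (halfSpaceCount d n) / n) atTop
      (𝓝 (Real.log (connectiveConstant d))) := by
  have hβ := connectiveConstant_pos d
  refine tendsto_order.2 ⟨fun x hx => ?_, fun x hx => ?_⟩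
  · obtain ⟨y, hxy, hy⟩ := exists_between hx
    have hlt : Real.exp y < connectiveConstant d := (Real.lt_log_iff_exp_lt hβ).1 hy
    obtain ⟨T, hT⟩ := exists_finset_lt_sum_inv_pow (d := d)
      (x := Real.exp y / connectiveConstant d) ((div_lt_one hβ).2 hlt)
    obtain ⟨c, hc, h⟩ := exists_mul_pow_le_halfSpaceCount T (Real.exp_pos y) (by
      calc (1 : ℝ) = connectiveConstant d / Real.exp y * (Real.exp y / connectiveConstant d) := by
            field_simp
        _ ≤ connectiveConstant d / Real.exp y *
            ∑ b ∈ T, (connectiveConstant d ^ b.length)⁻¹ := by gcongr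
        _ ≤ _ := by
          rw [Finset.mul_sum]
          refine Finset.sum_le_sum fun b _ => ?_
          -- A bridge has at least one step, so replacing β by `exp y < β` enlarges its weight by at
          -- least the factor `β / exp y`; only this one factor is kept.
          obtain ⟨k, hk⟩ : ∃ k, b.length = k + 1 := ⟨b.length - 1, by have := b.length_pos; omega⟩
          have : (connectiveConstant d ^ k)⁻¹ ≤ (Real.exp y ^ k)⁻¹ := by gcongr
          rw [hk, pow_succ, pow_succ, mul_inv, mul_inv]
          calc _ = (connectiveConstant d ^ k)⁻¹ * (Real.exp y)⁻¹ := by field_simp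
            _ ≤ _ := by gcongr)
    have h1 : Tendsto (fun n : ℕ => Real.log c / n + y) atTop (𝓝 (0 + y)) :=
      (tendsto_const_div_atTop_nhds_zero_nat _).add_const _
    rw [zero_add] at h1
    filter_upwards [h1.eventually_const_lt hxy, eventually_gt_atTop 0] with n h2 hn
    have hn' : (0 : ℝ) < n := by exact_mod_cast hn
    refine h2.trans_le ?_
    rw [div_add' _ _ _ hn'.ne', div_le_div_iff_of_pos_right hn']
    have h3 := Real.log_le_log (by positivity) (h n)
    rwa [Real.log_mul hc.ne' (by positivity), Real.log_pow, Real.log_exp, mul_comm (n : ℝ)] at h3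
  · filter_upwards [(exists_tendsto_sawCount d).2.2.1.eventually_lt_const hx] with n h
    refine lt_of_le_of_lt ?_ h
    gcongr
    · exact_mod_cast halfSpaceCount_pos d n
    · exact halfSpaceCount_le_sawCount n

end Connective

/-! ### Hooks are frequent -/

section ManyHooks

variable {d : ℕ} [NeZero d]

/-- The plane walk with the given coordinates, in the directions `0` and `i`. -/
def planeWalk (i : Fin d) (a b : ℕ → ℤ) : ℕ → Site d :=
  fun j k => if k = 0 then a j else if k = i then b j else 0

lemma planeWalk_mem {i : Fin d} (hi : i ≠ 0) {a b : ℕ → ℤ} {n : ℕ} (h0 : a 0 = 0 ∧ b 0 = 0)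
    (hstep : ∀ j < n, |a (j + 1) - a j| + |b (j + 1) - b j| = 1)
    (hinj : ∀ j ≤ n, ∀ k ≤ n, a j = a k → b j = b k → j = k)
    (hend : ∀ j, n ≤ j → a j = a n ∧ b j = b n) :
    planeWalk i a b ∈ selfAvoidingWalks d n := by
  refine ⟨?_, fun j hj => ?_, fun j hj k hk e => ?_, fun j hj => ?_⟩
  · funext k; simp [planeWalk, h0]
  · rw [Fintype.sum_eq_add 0 i hi.symm fun k hk => by simp [planeWalk, hk]]
    simpa [planeWalk, hi] using hstep j hj
  · have e0 := congrFun e 0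
    have ei := congrFun e i
    simp only [planeWalk, hi, if_true, if_false] at e0 ei
    exact hinj j hj k hk e0 ei
  · funext k
    simp [planeWalk, hend j hj]

/-- An explicit 8-step bridge whose heights are 0, 1, 1, 2, 2, 2, 1, 1, 2. The return from height 2
to height 1 excludes renewal times, and a hook starts at time 1. -/
lemma exists_irreducibleBridge_hooks_nonempty {i : Fin d} (hi : i ≠ 0) :
    ∃ b : IrreducibleBridge d, (hooks (Pi.single i 1) b.length b.path).Nonempty := by
  set a : ℕ → ℤ := fun j => [0, 1, 1, 2, 2, 2, 1, 1].getD j 2 with ha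
  set b : ℕ → ℤ := fun j => [0, 0, 1, 1, 0, -1, -1, -2].getD j (-2) with hb
  have h0 : ∀ j, planeWalk i a b j 0 = a j := fun j => by simp [planeWalk]
  have hapos : ∀ j, j < 9 → 1 ≤ j → 0 < a j ∧ a j ≤ a 8 := by decide
  have hmem : planeWalk i a b ∈ selfAvoidingWalks d 8 := by
    refine planeWalk_mem hi (by decide) (by decide) ?_ fun j hj => ?_
    · have : ∀ j < 9, ∀ k < 9, a j = a k → b j = b k → j = k := by decide
      exact fun j hj k hk => this j (by omega) k (by omega)
    · constructor
      · simp only [ha]; rw [List.getD_eq_default _ _ (by simpa using hj)]; rfl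
      · simp only [hb]; rw [List.getD_eq_default _ _ (by simpa using hj)]; rfl
  refine ⟨⟨8, planeWalk i a b, by norm_num, ⟨hmem, fun j h1 h2 => ?_⟩, fun j h1 h2 => ?_, ?_⟩,
    1, mem_hooks.2 ⟨by norm_num, ?_, ?_⟩⟩
  · rw [h0]; exact (hapos j (by omega) h1).1
  · rw [h0, h0, h0]; exact hapos j (by omega) h1
  · rintro j ⟨h1, h2, h⟩
    simp only [h0] at h
    have : ∀ j < 8, 1 ≤ j → ¬ ((∀ k < 9, k ≤ j → a k ≤ a j) ∧ ∀ m < 9, j < m → a j < a m) := by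
      decide
    exact this j h2 h1 ⟨fun k _ hk => (h k 8 hk h2 le_rfl).1,
      fun m hm hjm => (h j m le_rfl hjm (by omega)).2⟩
  · funext k
    by_cases h0 : k = 0
    · subst h0; simp [planeWalk, ha, hi.symm]
    · by_cases hk : k = i
      · simp [planeWalk, hb, hk, hi]
      · simp [planeWalk, h0, hk]
  · funext k
    by_cases h0 : k = 0
    · subst h0; simp [planeWalk, ha, hi.symm]
    · by_cases hk : k = i
      · simp [planeWalk, hb, hk, hi]
      · simp [planeWalk, h0, hk]

/-- Giving a smaller weight to hooks decreases the growth rate. -/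
lemma partitionFunction_rate_lt {i : Fin d} (hi : i ≠ 0) {s : ℝ≥0} (hs0 : 0 < s) (hs : s < 1) :
    ∃ l < Real.log (connectiveConstant d), Tendsto (fun n : ℕ =>
      Real.log (partitionFunction (Pi.single i 1 : Site d) s n) / n) atTop (𝓝 l) := by
  set v : Site d := Pi.single i 1
  have hβ := connectiveConstant_pos d
  obtain ⟨l, h1, h2⟩ := exists_tendsto_log_partitionFunction hs0 hs.le v
  refine ⟨l, lt_of_le_of_ne ?_ fun e => ?_, h1⟩
  · refine le_of_tendsto_of_tendsto' h1 (exists_tendsto_sawCount d).2.2.1 fun n => ?_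
    gcongr
    · exact_mod_cast partitionFunction_pos hs0 hs.le n
    · have := partitionFunction_mono (v := v) hs.le n
      rw [partitionFunction_one] at this
      exact_mod_cast this
  -- If the rates agreed, the weighted series of irreducible bridges would be at least 1 at 1/β,
  -- where the unweighted series equals 1; but one term is strictly smaller because its bridge has a
  -- hook.
  · have h3 := one_le_genFun_irreduciblePairs (v := v) (by simp [v, hi.symm]) hs.le h2
    rw [e, Real.exp_log hβ, genFun_irreduciblePairs] at h3
    obtain ⟨b, hb⟩ := exists_irreducibleBridge_hooks_nonempty hi
    set z := (connectiveConstant d).toNNReal⁻¹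
    have hz : 0 < z := inv_pos.2 (Real.toNNReal_pos.2 hβ)
    have hle : ∀ b : IrreducibleBridge d,
        weight v s z (b.length, b.path) ≤ weight v 1 z (b.length, b.path) := fun b => by
      simp only [weight, ENNReal.coe_le_coe]
      gcongr
    have hone : ∑' b : IrreducibleBridge d, weight v 1 z (b.length, b.path) = 1 := by
      simpa only [z, weight_one_eq v hβ] using tsum_inv_pow_eq_one d
    refine absurd h3 (not_le.2 ?_)
    rw [← hone]
    refine ENNReal.tsum_lt_tsum (i := b) ?_ hle ?_
    · exact ((ENNReal.tsum_le_tsum hle).trans_lt (hone ▸ ENNReal.one_lt_top)).ne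
    · simp only [weight, ENNReal.coe_lt_coe, one_pow, mul_one]
      exact mul_lt_of_lt_one_right (pow_pos hz _) (pow_lt_one₀ zero_le hs hb.card_pos.ne')

/-- Half-space walks with few hooks are rare. -/
lemma exists_card_few_hooks_le {i : Fin d} (hi : i ≠ 0) : ∃ a > 0, ∀ᶠ n : ℕ in atTop,
    (n : ℝ) ^ 2 * ((halfSpaceFinset d n).filter fun ω =>
      ((hooks (Pi.single i 1) n ω).card : ℝ) < a * n).card ≤ halfSpaceCount d n := by
  set v : Site d := Pi.single i 1
  obtain ⟨l, hl, hlim⟩ := partitionFunction_rate_lt (d := d) hi (s := 2⁻¹) (by norm_num)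
    (by norm_num)
  set L := Real.log (connectiveConstant d)
  set δ := (L - l) / 4 with hδ
  have hδ0 : 0 < δ := by simp only [hδ]; linarith
  have hlog2 : 0 < Real.log 2 := Real.log_pos one_lt_two
  -- With `s = 1/2`, a walk with fewer than `δ n / log 2` hooks has weight at least `exp (-δ n)`.
  -- There are thus at most `exp ((l + 2δ) n)` such walks, against `exp ((L - δ) n)` in all. Since
  -- `L - l = 4δ`, a factor `exp (-δ n)` is left to beat `n ^ 2`.
  refine ⟨δ / Real.log 2, by positivity, ?_⟩
  have hexp : Tendsto (fun n : ℕ => (n : ℝ) ^ 2 * Real.exp (-δ * n)) atTop (𝓝 0) := by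
    refine (tendsto_pow_const_mul_const_pow_of_abs_lt_one 2 (r := Real.exp (-δ)) ?_).congr
      fun n => by rw [← Real.exp_nat_mul, mul_comm (n : ℝ) (-δ)]
    rw [abs_of_pos (Real.exp_pos _)]
    simpa using hδ0
  filter_upwards [hlim.eventually_lt_const (show l < l + δ by linarith),
    (tendsto_log_halfSpaceCount d).eventually_const_lt (show L - δ < L by linarith),
    hexp.eventually_lt_const one_pos, eventually_gt_atTop 0] with n h1 h2 h3 hn
  have hn' : (0 : ℝ) < n := by exact_mod_cast hn
  rw [div_lt_iff₀ hn'] at h1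
  rw [lt_div_iff₀ hn'] at h2
  have hZ : (partitionFunction v 2⁻¹ n : ℝ) ≤ Real.exp ((l + δ) * n) :=
    (Real.log_le_iff_le_exp (NNReal.coe_pos.2
      (partitionFunction_pos (by norm_num) (by norm_num) n))).1 h1.le
  have hY : Real.exp ((L - δ) * n) ≤ halfSpaceCount d n :=
    (Real.le_log_iff_exp_le (by exact_mod_cast halfSpaceCount_pos d n)).1 h2.le
  set F := (halfSpaceFinset d n).filter fun ω => ((hooks v n ω).card : ℝ) < δ / Real.log 2 * n
  have hF : Real.exp (-δ * n) * F.card ≤ partitionFunction v 2⁻¹ n := by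
    calc Real.exp (-δ * n) * F.card = ∑ _ω ∈ F, Real.exp (-δ * n) := by simp [mul_comm]
      _ ≤ ∑ ω ∈ F, (((2⁻¹ : ℝ≥0) ^ (hooks v n ω).card : ℝ≥0) : ℝ) := by
        refine Finset.sum_le_sum fun ω hω => ?_
        have h4 := (Finset.mem_filter.1 hω).2
        rw [div_mul_eq_mul_div, lt_div_iff₀ hlog2] at h4
        push_cast
        rw [inv_pow, ← Real.exp_log (show (0 : ℝ) < 2 ^ (hooks v n ω).card by positivity),
          ← Real.exp_neg, Real.log_pow, Real.exp_le_exp]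
        linarith
      _ ≤ _ := by
        rw [← NNReal.coe_sum, NNReal.coe_le_coe, partitionFunction]
        refine Finset.sum_le_sum_of_subset fun ω hω => ?_
        have := mem_halfSpaceFinset.1 (Finset.mem_filter.1 hω).1
        simpa using this.1
  calc (n : ℝ) ^ 2 * F.card
      = (n : ℝ) ^ 2 * Real.exp (δ * n) * (Real.exp (-δ * n) * F.card) := by
        rw [show (n : ℝ) ^ 2 * Real.exp (δ * n) * (Real.exp (-δ * n) * F.card) =
          (n : ℝ) ^ 2 * (Real.exp (δ * n) * Real.exp (-δ * n)) * F.card by ring, ← Real.exp_add]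
        simp
    _ ≤ (n : ℝ) ^ 2 * Real.exp (δ * n) * Real.exp ((l + δ) * n) := by
        gcongr; exact hF.trans hZ
    _ = ((n : ℝ) ^ 2 * Real.exp (-δ * n)) * Real.exp ((L - δ) * n) := by
        rw [mul_assoc, mul_assoc, ← Real.exp_add, ← Real.exp_add]
        congr 2
        simp only [hδ]; ring
    _ ≤ 1 * Real.exp ((L - δ) * n) := by gcongr
    _ ≤ _ := by rwa [one_mul]

end ManyHooks

/-! ### Insertion and removal of hooks -/

/-- Replace step `j` of the walk `ω` by the detour through `ω j + v` and `ω (j + 1) + v`. -/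
def insertHook {d : ℕ} (v : Site d) (j : ℕ) (ω : ℕ → Site d) : ℕ → Site d := fun i =>
  if i ≤ j then ω i else if i = j + 1 then ω j + v else if i = j + 2 then ω (j + 1) + v
  else ω (i - 2)

/-- Remove the sites `ω (j + 1)` and `ω (j + 2)`. -/
def removeHook {d : ℕ} (j : ℕ) (ω : ℕ → Site d) : ℕ → Site d := fun i =>
  if i ≤ j then ω i else ω (i + 2)

open Classical in
/-- The steps of an `n`-step walk at which a hook can be inserted. -/
noncomputable def slots {d : ℕ} (v : Site d) (n : ℕ) (ω : ℕ → Site d) : Finset ℕ :=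
  (Finset.range n).filter fun j => 1 ≤ j ∧ ∀ i, ω i ≠ ω j + v ∧ ω i ≠ ω (j + 1) + v

section InsertHook

variable {d : ℕ} {v : Site d} {n j : ℕ} {ω : ℕ → Site d}

lemma mem_slots : j ∈ slots v n ω ↔
    j < n ∧ 1 ≤ j ∧ ∀ i, ω i ≠ ω j + v ∧ ω i ≠ ω (j + 1) + v := by
  classical
  simp [slots]

lemma card_slots_le : (slots v n ω).card ≤ n := by
  classical
  exact (Finset.card_filter_le _ _).trans (by simp)

lemma insertHook_of_le {i : ℕ} (h : i ≤ j) : insertHook v j ω i = ω i := by simp [insertHook, h]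

lemma insertHook_add_one : insertHook v j ω (j + 1) = ω j + v := by simp [insertHook]

lemma insertHook_add_two : insertHook v j ω (j + 2) = ω (j + 1) + v := by simp [insertHook]

lemma insertHook_of_lt {i : ℕ} (h : j < i) : insertHook v j ω (i + 2) = ω i := by
  simp only [insertHook]
  rw [if_neg (by omega), if_neg (by omega), if_neg (by omega), Nat.add_sub_cancel]

lemma index_cases (j i : ℕ) : i ≤ j ∨ i = j + 1 ∨ i = j + 2 ∨ ∃ k, j < k ∧ i = k + 2 := by
  rcases le_or_gt i j with h | h
  · exact .inl h
  · by_cases h1 : i = j + 1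
    · exact .inr (.inl h1)
    · by_cases h2 : i = j + 2
      · exact .inr (.inr (.inl h2))
      · exact .inr (.inr (.inr ⟨i - 2, by omega, by omega⟩))

lemma insertHook_cases (v : Site d) (j : ℕ) (ω : ℕ → Site d) (i : ℕ) :
    (∃ k, insertHook v j ω i = ω k) ∨ insertHook v j ω i = ω j + v ∨
      insertHook v j ω i = ω (j + 1) + v := by
  rcases index_cases j i with h | rfl | rfl | ⟨k, h, rfl⟩
  · exact .inl ⟨i, insertHook_of_le h⟩
  · exact .inr (.inl insertHook_add_one)
  · exact .inr (.inr insertHook_add_two)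
  · exact .inl ⟨k, insertHook_of_lt h⟩

lemma removeHook_insertHook : removeHook j (insertHook v j ω) = ω := by
  funext i
  rcases le_or_gt i j with h | h
  · simp [removeHook, h, insertHook_of_le h]
  · simp [removeHook, not_le.2 h, insertHook_of_lt h]

lemma insertHook_removeHook (h : j ∈ hooks v n ω) : insertHook v j (removeHook j ω) = ω := by
  obtain ⟨h1, h2, h3⟩ := mem_hooks.1 h
  funext i
  rcases index_cases j i with h | rfl | rfl | ⟨k, h, rfl⟩
  · rw [insertHook_of_le h]; simp [removeHook, h]
  · rw [insertHook_add_one, h2]; simp [removeHook]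
  · rw [insertHook_add_two, h3]; simp [removeHook]
  · rw [insertHook_of_lt h]; simp [removeHook, not_le.2 h]

lemma mem_hooks_insertHook (h : j < n) : j ∈ hooks v (n + 2) (insertHook v j ω) :=
  mem_hooks.2 ⟨by omega, by rw [insertHook_add_one, insertHook_of_le le_rfl],
    by rw [insertHook_add_two, insertHook_of_lt (i := j + 1) (by omega)]⟩

lemma insertHook_mem_selfAvoidingWalks (hv : ∑ k, |v k| = 1) (h : ω ∈ selfAvoidingWalks d n)
    (hj : j ∈ slots v n ω) : insertHook v j ω ∈ selfAvoidingWalks d (n + 2) := by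
  obtain ⟨hjn, hj1, hfree⟩ := mem_slots.1 hj
  have hne : ω j ≠ ω (j + 1) := fun e => by
    have := h.2.2.1 (show j ∈ Set.Iic n by simp; omega) (show j + 1 ∈ Set.Iic n by simp; omega) e
    omega
  refine ⟨by rw [insertHook_of_le (by omega), h.1], fun k hk => ?_, fun k hk l hl e => ?_,
    fun k hk => ?_⟩
  · rcases index_cases j k with hkj | rfl | rfl | ⟨k, hkj, rfl⟩
    · rcases hkj.lt_or_eq with hkj' | rfl
      · rw [insertHook_of_le hkj, insertHook_of_le (by omega)]
        exact h.2.1 k (by omega)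
      · rw [insertHook_of_le le_rfl, insertHook_add_one]
        simpa using hv
    · rw [insertHook_add_one, insertHook_add_two]
      simpa using h.2.1 j hjn
    · rw [insertHook_add_two, show j + 2 + 1 = (j + 1) + 2 by ring, insertHook_of_lt (by omega)]
      simpa using hv
    · rw [insertHook_of_lt hkj, show k + 2 + 1 = (k + 1) + 2 by ring, insertHook_of_lt (by omega)]
      exact h.2.1 k (by omega)
  · simp only [Set.mem_Iic] at hk hl
    rcases index_cases j k with hkj | rfl | rfl | ⟨k, hkj, rfl⟩ <;>
      rcases index_cases j l with hlj | rfl | rfl | ⟨l, hlj, rfl⟩ <;>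
      simp only [insertHook_of_le, insertHook_add_one, insertHook_add_two, insertHook_of_lt,
        *] at e
    any_goals first
      | rfl
      | exact absurd e (hfree _).1
      | exact absurd e (hfree _).2
      | exact absurd e.symm (hfree _).1
      | exact absurd e.symm (hfree _).2
      | exact absurd (add_left_injective v e) hne
      | exact absurd (add_left_injective v e).symm hne
      | skip
    · exact h.2.2.1 (by simp; omega) (by simp; omega) e
    · have := h.2.2.1 (show k ∈ Set.Iic n by simp; omega) (show l ∈ Set.Iic n by simp; omega) e
      omega
    · have := h.2.2.1 (show k ∈ Set.Iic n by simp; omega) (show l ∈ Set.Iic n by simp; omega) e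
      omega
    · have := h.2.2.1 (show k ∈ Set.Iic n by simp; omega) (show l ∈ Set.Iic n by simp; omega) e
      omega
  · obtain ⟨k, rfl⟩ : ∃ i, k = i + 2 := ⟨k - 2, by omega⟩
    rw [insertHook_of_lt (by omega), insertHook_of_lt hjn, h.2.2.2 k (by omega)]

/-- Only the hooks starting at `j - 2, …, j + 2` can be new; every other one comes from a hook of
`ω`, shifted by 2 if it lies after the insertion. -/
lemma card_hooks_insertHook_le (hj : j < n) : (hooks v (n + 2) (insertHook v j ω)).card ≤
    (hooks v n ω).card + 5 := by
  refine (Finset.card_le_card_sdiff_add_card (t := Finset.Icc (j - 2) (j + 2))).trans ?_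
  refine add_le_add ?_ (by simp; omega)
  have hout : ∀ k ∈ hooks v (n + 2) (insertHook v j ω) \ Finset.Icc (j - 2) (j + 2),
      k + 3 ≤ j ∨ ∃ i, j < i ∧ k = i + 2 := fun k hk => by
    simp only [Finset.mem_sdiff, Finset.mem_Icc] at hk
    by_cases h : k + 3 ≤ j
    · exact .inl h
    · exact .inr ⟨k - 2, by omega, by omega⟩
  refine Finset.card_le_card_of_injOn (fun k => if k ≤ j then k else k - 2)
    (fun k hk => ?_) fun k hk l hl e => ?_
  · obtain ⟨h1, h2, h3⟩ := mem_hooks.1 (Finset.mem_sdiff.1 hk).1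
    rcases hout k hk with h | ⟨i, h, rfl⟩
    · rw [insertHook_of_le (by omega), insertHook_of_le (by omega)] at h2
      rw [insertHook_of_le (by omega), insertHook_of_le (by omega)] at h3
      simp only [if_pos (show k ≤ j by omega)]
      exact mem_hooks.2 ⟨by omega, h2, h3⟩
    · rw [show i + 2 + 1 = (i + 1) + 2 by ring, insertHook_of_lt (by omega),
        insertHook_of_lt h] at h2
      rw [insertHook_of_lt (by omega), show i + 2 + 3 = (i + 3) + 2 by ring,
        insertHook_of_lt (by omega)] at h3
      simp only [if_neg (show ¬ i + 2 ≤ j by omega), Nat.add_sub_cancel]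
      exact mem_hooks.2 ⟨by omega, h2, h3⟩
  · rcases hout k hk with h | ⟨i, h, rfl⟩ <;> rcases hout l hl with h' | ⟨i', h', rfl⟩ <;>
      simp only at e <;> split_ifs at e <;> omega

/-- Only the hooks that use step `j`, hence start at `j - 2, …, j`, can be lost. -/
lemma card_hooks_le_insertHook : (hooks v n ω).card ≤
    (hooks v (n + 2) (insertHook v j ω)).card + 3 := by
  refine (Finset.card_le_card_sdiff_add_card (t := Finset.Icc (j - 2) j)).trans ?_
  refine add_le_add ?_ (by simp; omega)
  refine Finset.card_le_card_of_injOn (fun k => if k ≤ j then k else k + 2)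
    (fun k hk => ?_) fun k hk l hl e => ?_
  · have hk' := Finset.mem_sdiff.1 hk
    rw [Finset.mem_Icc] at hk'
    obtain ⟨h1, h2, h3⟩ := mem_hooks.1 hk'.1
    rcases le_or_gt k j with h | h
    · simp only [if_pos h]
      refine mem_hooks.2 ⟨by omega, ?_, ?_⟩
      · rwa [insertHook_of_le (by omega), insertHook_of_le (by omega)]
      · rwa [insertHook_of_le (by omega), insertHook_of_le (by omega)]
    · simp only [if_neg (not_le.2 h)]
      refine mem_hooks.2 ⟨by omega, ?_, ?_⟩
      · rwa [show k + 2 + 1 = (k + 1) + 2 by ring, insertHook_of_lt (by omega), insertHook_of_lt h]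
      · rwa [insertHook_of_lt (by omega), show k + 2 + 3 = (k + 3) + 2 by ring,
          insertHook_of_lt (by omega)]
  · simp only at e
    split_ifs at e <;> omega

/-- The two new sites are `ω j + v` and `ω (j + 1) + v`. By self-avoidance they can block a slot `k`
only if `k` is one of `j - 1, j, j + 1`. -/
lemma card_slots_le_insertHook (h : ω ∈ selfAvoidingWalks d n) (hj : j ∈ slots v n ω) :
    (slots v n ω).card ≤ (slots v (n + 2) (insertHook v j ω)).card + 3 := by
  obtain ⟨hjn, hj1, hfree⟩ := mem_slots.1 hj
  refine (Finset.card_le_card_sdiff_add_card (t := Finset.Icc (j - 1) (j + 1))).trans ?_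
  refine add_le_add ?_ (by simp; omega)
  have hinj : ∀ k l, k ≤ n → l ≤ n → ω k + v = ω l + v → k = l := fun k l hk hl e =>
    h.2.2.1 hk hl (add_left_injective v e)
  refine Finset.card_le_card_of_injOn (fun k => if k ≤ j then k else k + 2)
    (fun k hk => ?_) fun k hk l hl e => ?_
  · have hk' := Finset.mem_sdiff.1 hk
    rw [Finset.mem_Icc] at hk'
    obtain ⟨hkn, hk1, hfree'⟩ := mem_slots.1 hk'.1
    have key : ∀ i, insertHook v j ω i ≠ ω k + v ∧ insertHook v j ω i ≠ ω (k + 1) + v := by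
      intro i
      rcases insertHook_cases v j ω i with ⟨m, hm⟩ | hm | hm <;> rw [hm]
      · exact hfree' m
      · exact ⟨fun e => by have := hinj _ _ hjn.le hkn.le e; omega,
          fun e => by have := hinj _ _ hjn.le hkn e; omega⟩
      · exact ⟨fun e => by have := hinj _ _ hjn hkn.le e; omega,
          fun e => by have := hinj _ _ hjn hkn e; omega⟩
    rcases le_or_gt k j with h | h
    · simp only [if_pos h]
      refine mem_slots.2 ⟨by omega, hk1, ?_⟩
      rwa [insertHook_of_le h, insertHook_of_le (by omega)]
    · simp only [if_neg (not_le.2 h)]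
      refine mem_slots.2 ⟨by omega, by omega, ?_⟩
      rwa [show k + 2 + 1 = (k + 1) + 2 by ring, insertHook_of_lt h, insertHook_of_lt (by omega)]
  · simp only at e
    split_ifs at e <;> omega

variable [NeZero d]

lemma insertHook_mem (hv0 : v 0 = 0) (hv : ∑ k, |v k| = 1) (h : ω ∈ halfSpaceWalks d n)
    (hj : j ∈ slots v n ω) : insertHook v j ω ∈ halfSpaceWalks d (n + 2) := by
  refine ⟨insertHook_mem_selfAvoidingWalks hv h.1 hj, fun k h1 hk => ?_⟩
  obtain ⟨hjn, hj1, -⟩ := mem_slots.1 hj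
  rcases index_cases j k with hkj | rfl | rfl | ⟨k, hkj, rfl⟩
  · rw [insertHook_of_le hkj]; exact h.2 k h1 (by omega)
  · rw [insertHook_add_one]; simpa [hv0] using h.2 j hj1 hjn.le
  · rw [insertHook_add_two]; simpa [hv0] using h.2 (j + 1) (by omega) hjn
  · rw [insertHook_of_lt hkj]; exact h.2 k (by omega) (by omega)

lemma removeHook_mem (hv0 : v 0 = 0) (h : ω ∈ halfSpaceWalks d (n + 2))
    (hj : j ∈ hooks v (n + 2) ω) :
    removeHook j ω ∈ halfSpaceWalks d n ∧ j ∈ slots v n (removeHook j ω) := by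
  obtain ⟨hjn, h2, h3⟩ := mem_hooks.1 hj
  have hj1 : 1 ≤ j := by
    -- A hook at time 0 would put `ω 1 = v` on the boundary hyperplane.
    by_contra hj0
    obtain rfl : j = 0 := by omega
    have := h.2 1 le_rfl (by omega)
    rw [zero_add] at h2
    simp [h2, h.1.1, hv0] at this
  have hle : ∀ i ≤ j, removeHook j ω i = ω i := fun i hi => by simp [removeHook, hi]
  have hlt : ∀ i, j < i → removeHook j ω i = ω (i + 2) := fun i hi => by
    simp [removeHook, not_le.2 hi]
  have hinj : ∀ k l, k ≤ n + 2 → l ≤ n + 2 → ω k = ω l → k = l := fun k l hk hl e =>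
    h.1.2.2.1 hk hl e
  have hend : ∀ i, n ≤ i → removeHook j ω i = removeHook j ω n := fun i hi => by
    rw [hlt i (by omega), hlt n (by omega), h.1.2.2.2 (i + 2) (by omega)]
  refine ⟨⟨⟨by rw [hle 0 (by omega), h.1.1], fun k hk => ?_, fun k hk l hl e => ?_, hend⟩,
    fun k h1 hk => ?_⟩, mem_slots.2 ⟨by omega, hj1, fun i => ?_⟩⟩
  · rcases lt_trichotomy k j with hkj | rfl | hkj
    · rw [hle k hkj.le, hle (k + 1) hkj]; exact h.1.2.1 k (by omega)
    · rw [hle k le_rfl, hlt (k + 1) (by omega)]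
      have h4 := h.1.2.1 (k + 1) (by omega)
      rw [show k + 1 + 1 = k + 2 by ring, h3, h2] at h4
      simpa [show k + 1 + 2 = k + 3 by ring] using h4
    · rw [hlt k hkj, hlt (k + 1) (by omega), show k + 1 + 2 = k + 2 + 1 by ring]
      exact h.1.2.1 (k + 2) (by omega)
  · simp only [Set.mem_Iic] at hk hl
    rcases le_or_gt k j with hkj | hkj <;> rcases le_or_gt l j with hlj | hlj
    · rw [hle k hkj, hle l hlj] at e
      exact hinj _ _ (by omega) (by omega) e
    · rw [hle k hkj, hlt l hlj] at e
      have := hinj _ _ (by omega) (by omega) e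
      omega
    · rw [hlt k hkj, hle l hlj] at e
      have := hinj _ _ (by omega) (by omega) e
      omega
    · rw [hlt k hkj, hlt l hlj] at e
      have := hinj _ _ (by omega) (by omega) e
      omega
  · rcases le_or_gt k j with hkj | hkj
    · rw [hle k hkj]; exact h.2 k h1 (by omega)
    · rw [hlt k hkj]; exact h.2 (k + 2) (by omega) (by omega)
  · have key : ∀ i ≤ n, removeHook j ω i ≠ removeHook j ω j + v ∧
        removeHook j ω i ≠ removeHook j ω (j + 1) + v := by
      intro i hi
      rw [hle j le_rfl, hlt (j + 1) (by omega), show j + 1 + 2 = j + 3 by ring, ← h2, ← h3]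
      rcases le_or_gt i j with hij | hij
      · rw [hle i hij]
        exact ⟨fun e => by have := hinj _ _ (by omega) (by omega) e; omega,
          fun e => by have := hinj _ _ (by omega) (by omega) e; omega⟩
      · rw [hlt i hij]
        exact ⟨fun e => by have := hinj _ _ (by omega) (by omega) e; omega,
          fun e => by have := hinj _ _ (by omega) (by omega) e; omega⟩
    rcases le_total i n with hi | hi
    · exact key i hi
    · rw [hend i hi]; exact key n le_rfl

/-- Inserting a hook in an `n`-step walk amounts to marking a hook of an `(n + 2)`-step walk. -/
lemma sum_slots_eq_sum_hooks (hv0 : v 0 = 0) (hv : ∑ k, |v k| = 1) (F : (ℕ → Site d) → ℝ) :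
    ∑ ω ∈ halfSpaceFinset d n, ∑ j ∈ slots v n ω, F (insertHook v j ω) =
      ∑ ω ∈ halfSpaceFinset d (n + 2), (hooks v (n + 2) ω).card * F ω := by
  simp only [← nsmul_eq_mul, ← Finset.sum_const]
  rw [Finset.sum_sigma', Finset.sum_sigma']
  refine Finset.sum_nbij' (fun p => ⟨insertHook v p.2 p.1, p.2⟩)
    (fun p => ⟨removeHook p.2 p.1, p.2⟩) ?_ ?_ ?_ ?_ ?_
  · rintro ⟨ω, j⟩ h
    simp only [Finset.mem_sigma, mem_halfSpaceFinset] at h ⊢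
    exact ⟨insertHook_mem hv0 hv h.1 h.2, mem_hooks_insertHook (mem_slots.1 h.2).1⟩
  · rintro ⟨ω, j⟩ h
    simp only [Finset.mem_sigma, mem_halfSpaceFinset] at h ⊢
    exact removeHook_mem hv0 h.1 h.2
  · rintro ⟨ω, j⟩ h
    simp [removeHook_insertHook]
  · rintro ⟨ω, j⟩ h
    simp only [Finset.mem_sigma] at h
    simp [insertHook_removeHook h.2]
  · rintro ⟨ω, j⟩ h
    rfl

end InsertHook

/-! ### Ratio limits in steps of two -/

section KestenLemma

/-- If `a n` grows like `exp (l * n)` and the ratios `φ n = a (n + 2) / a n` are almost increasing,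
then they converge. -/
lemma tendsto_ratio_of_almost_increasing {a : ℕ → ℝ} {l D : ℝ} (ha : ∀ n, 0 < a n)
    (hl : Tendsto (fun n : ℕ => Real.log (a n) / n) atTop (𝓝 l)) (hD : 0 ≤ D)
    (hφ : ∀ᶠ n : ℕ in atTop, a (n + 2) / a n - D / n ≤ a (n + 4) / a (n + 2)) :
    Tendsto (fun n => a (n + 2) / a n) atTop (𝓝 (Real.exp (2 * l))) := by
  set φ : ℕ → ℝ := fun n => a (n + 2) / a n with hφdef
  have hφpos : ∀ n, 0 < φ n := fun n => div_pos (ha _) (ha _)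
  obtain ⟨N, hN⟩ := eventually_atTop.1 hφ
  have htel : ∀ n, N ≤ n → 0 < n → ∀ j : ℕ, φ n - D * j / n ≤ φ (n + 2 * j) := by
    intro n hn hn0 j
    induction j with
    | zero => simp
    | succ j ih =>
      have h1 := hN (n + 2 * j) (by omega)
      have h2 : D / ((n + 2 * j : ℕ) : ℝ) ≤ D / n := by
        gcongr
        omega
      have h3 : φ (n + 2 * (j + 1)) = a (n + 2 * j + 4) / a (n + 2 * j + 2) := rfl
      rw [h3]
      have h4 : φ (n + 2 * j) = a (n + 2 * j + 2) / a (n + 2 * j) := rfl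
      rw [h4] at ih
      have h5 : D * ((j + 1 : ℕ) : ℝ) / n = D * j / n + D / n := by push_cast; ring
      rw [h5]
      linarith
  have hlog : ∀ n J : ℕ, Real.log (a (n + 2 * J)) - Real.log (a n) =
      ∑ j ∈ Finset.range J, Real.log (φ (n + 2 * j)) := by
    intro n J
    induction J with
    | zero => simp
    | succ J ih =>
      rw [Finset.sum_range_succ, ← ih, hφdef]
      simp only
      rw [Real.log_div (ha _).ne' (ha _).ne', show n + 2 * (J + 1) = n + 2 * J + 2 by ring]
      ring
  have hdev : ∀ η > 0, ∀ᶠ n : ℕ in atTop, |Real.log (a n) - l * n| ≤ η * n := by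
    intro η hη
    filter_upwards [(Metric.tendsto_nhds.1 hl) η hη, eventually_gt_atTop 0] with n h hn
    have hn' : (0 : ℝ) < n := by exact_mod_cast hn
    rw [Real.dist_eq, div_sub' hn'.ne', abs_div, abs_of_pos hn', div_lt_iff₀ hn'] at h
    rw [mul_comm l]
    exact h.le
  have key : ∀ ε > 0, ε < Real.exp (2 * l) → ∃ δ > 0, δ ≤ 1 / 4 ∧ 2 * D * δ ≤ ε := by
    intro ε hε _
    refine ⟨min (1 / 4) (ε / (2 * D + 1)), by positivity, min_le_left _ _, ?_⟩
    calc 2 * D * min (1 / 4) (ε / (2 * D + 1)) ≤ (2 * D + 1) * (ε / (2 * D + 1)) := by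
          gcongr
          · linarith
          · exact min_le_right _ _
      _ = ε := by field_simp
  have hexp : 0 < Real.exp (2 * l) := Real.exp_pos _
  refine Metric.tendsto_nhds.2 fun ε' hε' => ?_
  obtain ⟨ε, hε, hεε', hεl⟩ : ∃ ε > 0, 2 * ε ≤ ε' ∧ 2 * ε < Real.exp (2 * l) :=
    ⟨min (ε' / 2) (Real.exp (2 * l) / 4), by positivity, by
      have := min_le_left (ε' / 2) (Real.exp (2 * l) / 4); linarith, by
      have := min_le_right (ε' / 2) (Real.exp (2 * l) / 4); linarith⟩
  obtain ⟨δ, hδ, hδ4, hδD⟩ := key ε hε (by linarith)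
  set c := Real.log (Real.exp (2 * l) + ε) with hc
  set c' := Real.log (Real.exp (2 * l) - ε) with hc'
  have hc1 : 2 * l < c := (Real.lt_log_iff_exp_lt (by positivity)).2 (by linarith)
  have hc1' : c' < 2 * l := (Real.log_lt_iff_lt_exp (by linarith)).2 (by linarith)
  -- A window of `J ≥ δ n / 2` ratios off by a fixed factor moves `log a` by more than `4 η n`,
  -- which exceeds the error in `log a n ≈ l n` at both ends of the window together.
  obtain ⟨η, hη, hη1, hη2⟩ : ∃ η > 0, 8 * η < δ * (c - 2 * l) ∧ 8 * η < δ * (2 * l - c') := by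
    have h1 : 0 < δ * (c - 2 * l) := mul_pos hδ (by linarith)
    have h2 : 0 < δ * (2 * l - c') := mul_pos hδ (by linarith)
    refine ⟨min (δ * (c - 2 * l)) (δ * (2 * l - c')) / 16, by positivity, ?_, ?_⟩
    · have := min_le_left (δ * (c - 2 * l)) (δ * (2 * l - c')); linarith
    · have := min_le_right (δ * (c - 2 * l)) (δ * (2 * l - c')); linarith
  obtain ⟨N', hN'⟩ := eventually_atTop.1 (hdev η hη)
  obtain ⟨N'', hN''⟩ := exists_nat_ge (2 / δ)
  filter_upwards [eventually_ge_atTop (2 * (N + N' + N'' + 1))] with n hn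
  have hn0 : (0 : ℝ) < n := by exact_mod_cast (show 0 < n by omega)
  -- The window is proportional to `n`, yet so short that the ratio drops by at most `ε` along it.
  set J := ⌊δ * n⌋₊ with hJ
  have hJle : (J : ℝ) ≤ δ * n := Nat.floor_le (by positivity)
  have hJ4 : 4 * J ≤ n := by
    have : (4 * J : ℝ) ≤ n := by nlinarith
    exact_mod_cast this
  have hJge : δ * n / 2 ≤ J := by
    have h1 := Nat.lt_floor_add_one (δ * n)
    have h2 : 2 / δ ≤ n := hN''.trans (by exact_mod_cast (show N'' ≤ n by omega))
    rw [div_le_iff₀ hδ] at h2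
    rw [← hJ] at h1
    linarith
  clear_value J
  refine lt_of_lt_of_le ?_ hεε'
  rw [Real.dist_eq, abs_lt]
  constructor
  · by_contra! hlt
    -- If the ratio is too small at `n`, it was too small throughout the window ending at `n`, since
    -- it can hardly decrease.
    obtain ⟨m, rfl⟩ : ∃ m, n = m + 2 * J := ⟨n - 2 * J, by omega⟩
    have hm0 : (0 : ℝ) < m := by exact_mod_cast (show 0 < m by omega)
    have hm2 : ((m + 2 * J : ℕ) : ℝ) ≤ 2 * m := by exact_mod_cast (show m + 2 * J ≤ 2 * m by omega)
    have h1 : ∀ j ∈ Finset.range J, Real.log (φ (m + 2 * j)) ≤ c' := by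
      intro j hj
      have hjJ := Finset.mem_range.1 hj
      have h2 := htel (m + 2 * j) (by omega) (by omega) (J - j)
      rw [show m + 2 * j + 2 * (J - j) = m + 2 * J by omega] at h2
      have h3 : D * ((J - j : ℕ) : ℝ) / ((m + 2 * j : ℕ) : ℝ) ≤ ε := by
        calc D * ((J - j : ℕ) : ℝ) / ((m + 2 * j : ℕ) : ℝ) ≤ D * J / m := by
              gcongr
              · omega
              · omega
          _ ≤ ε := by
              rw [div_le_iff₀ hm0]
              nlinarith
      refine Real.log_le_log (hφpos _) ?_
      linarith
    have h2 := Finset.sum_le_card_nsmul _ _ _ h1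
    rw [← hlog, Finset.card_range, nsmul_eq_mul] at h2
    have h3 := abs_le.1 (hN' m (by omega))
    have h4 := abs_le.1 (hN' (m + 2 * J) (by omega))
    push_cast at h3 h4 hJge hn0
    nlinarith [mul_le_mul_of_nonneg_right hJge (show (0 : ℝ) ≤ 2 * l - c' by linarith),
      mul_lt_mul_of_pos_right hη2 hn0]
  · by_contra! hlt
    -- If the ratio is too large at `n`, it remains too large throughout the window starting at `n`.
    have h1 : ∀ j ∈ Finset.range J, c ≤ Real.log (φ (n + 2 * j)) := by
      intro j hj
      have hjJ := Finset.mem_range.1 hj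
      have h2 := htel n (by omega) (by omega) j
      have h3 : D * j / n ≤ ε := by
        rw [div_le_iff₀ hn0]
        have : (j : ℝ) ≤ J := by exact_mod_cast hjJ.le
        nlinarith
      refine Real.log_le_log (by positivity) ?_
      linarith
    have h2 := Finset.card_nsmul_le_sum _ _ _ h1
    rw [← hlog, Finset.card_range, nsmul_eq_mul] at h2
    have h3 := abs_le.1 (hN' n (by omega))
    have h4 := abs_le.1 (hN' (n + 2 * J) (by omega))
    have h5 : (J : ℝ) ≤ n := by exact_mod_cast (show J ≤ n by omega)
    push_cast at h4
    nlinarith [mul_le_mul_of_nonneg_right hJge (show (0 : ℝ) ≤ c - 2 * l by linarith),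
      mul_lt_mul_of_pos_right hη1 hn0]

end KestenLemma

/-- A walk with at least `a n` hooks contributes O(1/n) because it has at most `n` slots. Otherwise
the crude bound `3 n` is enough, as such walks will form a fraction at most `n ^ (-2)`. -/
lemma slots_div_hooks_le {d : ℕ} {v : Site d} {n : ℕ} (hn : 0 < n) {a : ℝ} (ha : 0 < a) (ω : ℕ → Site d) :
    3 * ((slots v n ω).card / ((hooks v n ω).card + 10 : ℝ)) / ((hooks v n ω).card + 5 : ℝ) ≤
      3 / a ^ 2 / n + if ((hooks v n ω).card : ℝ) < a * n then 3 * (n : ℝ) else 0 := by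
  have hn' : (0 : ℝ) < n := by exact_mod_cast hn
  have hE : ((slots v n ω).card : ℝ) ≤ n := by exact_mod_cast card_slots_le
  have hE0 : (0 : ℝ) ≤ (slots v n ω).card := by positivity
  have hU0 : (0 : ℝ) ≤ (hooks v n ω).card := by positivity
  generalize ((slots v n ω).card : ℝ) = E at *
  generalize ((hooks v n ω).card : ℝ) = U at *
  split_ifs with h
  · have h4 : E / (U + 10) ≤ n := (div_le_self hE0 (by linarith)).trans hE
    have h5 : 3 * (E / (U + 10)) / (U + 5) ≤ 3 * (E / (U + 10)) :=
      div_le_self (by positivity) (by linarith)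
    have h6 : 0 ≤ 3 / a ^ 2 / (n : ℝ) := by positivity
    linarith
  · have h4 : a * n ≤ U := not_lt.1 h
    calc 3 * (E / (U + 10)) / (U + 5) ≤ 3 * (n / (a * n)) / (a * n) := by
          gcongr
          · linarith
          · linarith
      _ = 3 / a ^ 2 / n + 0 := by field_simp; ring

/-! ### First and second moments of the slot-to-hook ratio -/

section Ratio

variable {d : ℕ} [NeZero d]

lemma halfSpaceCount_le_succ (n : ℕ) : halfSpaceCount d n ≤ halfSpaceCount d (n + 1) := by
  rw [← card_halfSpaceFinset, ← card_halfSpaceFinset]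
  refine Finset.card_le_card_of_injOn prepend (fun η hη => ?_) prepend_injective.injOn
  have hη' : η ∈ halfSpaceWalks d n := by simpa using hη
  refine Finset.mem_coe.2 (mem_halfSpaceFinset.2 (prepend_mem hη'.1 fun j hj => ?_))
  rcases Nat.eq_zero_or_pos j with rfl | hj0
  · simp [hη'.1.1]
  · exact (hη'.2 j hj0 hj).le

lemma halfSpaceCount_add_le (m n : ℕ) :
    halfSpaceCount d (m + n) ≤ halfSpaceCount d m * sawCount d n := by
  have h : sawCount d n = (selfAvoidingWalks_finite d n).toFinset.card :=
    Set.ncard_eq_toFinset_card _ _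
  rw [← card_halfSpaceFinset, ← card_halfSpaceFinset, h, ← Finset.card_product]
  refine Finset.card_le_card_of_injOn (fun ω => (stopAt m ω, tailAt m ω)) (fun ω hω => ?_)
    fun ω _ ω' _ e => ?_
  · have hω' : ω ∈ halfSpaceWalks d (m + n) := by simpa using hω
    refine Finset.mem_coe.2 (Finset.mem_product.2 ⟨mem_halfSpaceFinset.2
      (stopAt_mem_halfSpaceWalks hω' (by omega)), (Set.Finite.mem_toFinset _).2 ?_⟩)
    simpa using tailAt_mem hω'.1 (Nat.le_add_right m n)
  · simp only [Prod.mk.injEq] at e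
    exact eq_of_stopAt_eq_of_tailAt_eq e.1 e.2

/-- The mean of the ratio of slots to hooks controls ratios of counts from above. -/
lemma halfSpaceCount_add_two_le {v : Site d} (hv0 : v 0 = 0) (hv : ∑ k, |v k| = 1) {a : ℝ}
    (ha : 0 < a) {n : ℕ} (hn : 0 < n) :
    (halfSpaceCount d (n + 2) : ℝ) ≤ ((halfSpaceFinset d (n + 2)).filter fun ω =>
      ((hooks v (n + 2) ω).card : ℝ) < a * (n + 2 : ℕ)).card + (1 + 13 / (a * n)) *
      ∑ ω ∈ halfSpaceFinset d n, (slots v n ω).card / ((hooks v n ω).card + 10 : ℝ) := by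
  have hn' : (0 : ℝ) < n := by exact_mod_cast hn
  have han : 0 < a * n := by positivity
  set P : (ℕ → Site d) → Prop := fun ω => ((hooks v (n + 2) ω).card : ℝ) < a * (n + 2 : ℕ)
  have hPc : ∀ ω, ¬ P ω → a * n ≤ (hooks v (n + 2) ω).card := fun ω hω => by
    refine le_trans ?_ (not_lt.1 hω)
    gcongr
    omega
  have hsplit := Finset.card_filter_add_card_filter_not (s := halfSpaceFinset d (n + 2)) P
  have h1 : (((halfSpaceFinset d (n + 2)).filter fun ω => ¬ P ω).card : ℝ) =
      ∑ ω ∈ halfSpaceFinset d n, ∑ j ∈ slots v n ω, (if P (insertHook v j ω) then (0 : ℝ)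
        else ((hooks v (n + 2) (insertHook v j ω)).card : ℝ)⁻¹) := by
    rw [sum_slots_eq_sum_hooks hv0 hv (fun ω => if P ω then (0 : ℝ)
        else ((hooks v (n + 2) ω).card : ℝ)⁻¹), Finset.card_filter, Nat.cast_sum]
    refine Finset.sum_congr rfl fun ω _ => ?_
    by_cases h : P ω
    · simp [h]
    · have := han.trans_le (hPc ω h)
      simp [h, this.ne']
  have h2 : (((halfSpaceFinset d (n + 2)).filter fun ω => ¬ P ω).card : ℝ) ≤
      (1 + 13 / (a * n)) *
      ∑ ω ∈ halfSpaceFinset d n, (slots v n ω).card / ((hooks v n ω).card + 10 : ℝ) := by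
    rw [h1, Finset.mul_sum]
    refine Finset.sum_le_sum fun ω _ => ?_
    have hsum : (1 + 13 / (a * n)) * ((slots v n ω).card / ((hooks v n ω).card + 10 : ℝ)) =
        ∑ _j ∈ slots v n ω, (1 + 13 / (a * n)) / ((hooks v n ω).card + 10 : ℝ) := by
      rw [Finset.sum_const, nsmul_eq_mul]; ring
    rw [hsum]
    refine Finset.sum_le_sum fun j hj => ?_
    split_ifs with h
    · positivity
    · have h3 := hPc _ h
      have h4 : ((hooks v n ω).card : ℝ) ≤ (hooks v (n + 2) (insertHook v j ω)).card + 3 := by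
        exact_mod_cast card_hooks_le_insertHook
      set u := ((hooks v (n + 2) (insertHook v j ω)).card : ℝ)
      have hu : 0 < u := han.trans_le h3
      -- 13 = 10 + 3: the shift 10 in the denominator, plus the at most 3 hooks lost by an
      -- insertion.
      have h5 : 13 ≤ 13 / (a * n) * u := by
        rw [div_mul_eq_mul_div, le_div_iff₀ han]; gcongr
      rw [inv_eq_one_div, div_le_div_iff₀ hu (by positivity)]
      linarith
  have h3 : (halfSpaceCount d (n + 2) : ℝ) = ((halfSpaceFinset d (n + 2)).filter P).card +
      ((halfSpaceFinset d (n + 2)).filter fun ω => ¬ P ω).card := by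
    rw [← card_halfSpaceFinset, ← hsplit]
    push_cast
    rfl
  rw [h3]
  gcongr

/-- The mean square of the ratio of slots to hooks controls ratios of counts from below. -/
lemma sum_sq_le_halfSpaceCount_add_four {v : Site d} (hv0 : v 0 = 0) (hv : ∑ k, |v k| = 1) (n : ℕ) :
    ∑ ω ∈ halfSpaceFinset d n, (((slots v n ω).card / ((hooks v n ω).card + 10 : ℝ)) ^ 2 -
      3 * ((slots v n ω).card / ((hooks v n ω).card + 10 : ℝ)) / ((hooks v n ω).card + 5)) ≤
      (halfSpaceCount d (n + 4) : ℝ) := by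
  -- Each walk of length `m + 2` arises once for each of its hooks, so dividing by their number
  -- counts it once. A walk without hooks contributes 0, whence only an inequality.
  have hstep : ∀ (m : ℕ) (G : (ℕ → Site d) → ℝ), (∀ ω, 0 ≤ G ω) →
      ∑ ω ∈ halfSpaceFinset d m, ∑ j ∈ slots v m ω, G (insertHook v j ω) /
        (hooks v (m + 2) (insertHook v j ω)).card ≤ ∑ ω ∈ halfSpaceFinset d (m + 2), G ω := by
    intro m G hG
    rw [sum_slots_eq_sum_hooks hv0 hv (fun ω => G ω / (hooks v (m + 2) ω).card)]
    refine Finset.sum_le_sum fun ω _ => ?_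
    rcases Nat.eq_zero_or_pos (hooks v (m + 2) ω).card with h | h
    · simpa [h] using hG ω
    · rw [mul_div_cancel₀ _ (by exact_mod_cast h.ne')]
  have hU : ∀ (m : ℕ) (ω : ℕ → Site d), ∀ j ∈ slots v m ω,
      0 < ((hooks v (m + 2) (insertHook v j ω)).card : ℝ) ∧
      ((hooks v (m + 2) (insertHook v j ω)).card : ℝ) ≤ (hooks v m ω).card + 5 := by
    intro m ω j hj
    have hjm := (mem_slots.1 hj).1
    refine ⟨?_, by exact_mod_cast card_hooks_insertHook_le hjm⟩
    exact_mod_cast Finset.card_pos.2 ⟨j, mem_hooks_insertHook hjm⟩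
  have hA : ∑ ω ∈ halfSpaceFinset d (n + 2),
      (slots v (n + 2) ω).card / ((hooks v (n + 2) ω).card + 5 : ℝ) ≤
      (halfSpaceCount d (n + 4) : ℝ) := by
    have h1 := hstep (n + 2) (fun _ => 1) fun _ => zero_le_one
    rw [Finset.sum_const, nsmul_one, card_halfSpaceFinset] at h1
    refine le_trans (Finset.sum_le_sum fun ω _ => ?_) h1
    rw [div_eq_mul_one_div, ← nsmul_eq_mul, ← Finset.sum_const]
    refine Finset.sum_le_sum fun j hj => ?_
    obtain ⟨h2, h3⟩ := hU _ ω j hj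
    gcongr
  refine le_trans ?_ hA
  refine le_trans (Finset.sum_le_sum fun ω hω => ?_)
    (hstep n (fun ω => (slots v (n + 2) ω).card / ((hooks v (n + 2) ω).card + 5 : ℝ))
      fun ω => by positivity)
  set E := ((slots v n ω).card : ℝ) with hE
  set U := ((hooks v n ω).card : ℝ) with hU'
  have hU0 : 0 ≤ U := by positivity
  have hE0 : 0 ≤ E := by positivity
  -- Two insertions: the first leaves at least `E - 3` slots and at most `U + 5` hooks, and a second
  -- one at most `U + 10` hooks. This is why the ratio is normalised by `U + 10`.
  calc (E / (U + 10)) ^ 2 - 3 * (E / (U + 10)) / (U + 5)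
      ≤ E * ((E - 3) / (U + 10) / (U + 5)) := by
        have h1 : E / (U + 10) * (E / (U + 10)) ≤ E / (U + 10) * (E / (U + 5)) := by
          gcongr
          norm_num
        have h2 : E * ((E - 3) / (U + 10) / (U + 5)) =
            E / (U + 10) * (E / (U + 5)) - 3 * (E / (U + 10)) / (U + 5) := by
          field_simp
        rw [h2, sq]
        linarith
    _ ≤ _ := by
        rw [hE, ← nsmul_eq_mul, ← Finset.sum_const]
        refine Finset.sum_le_sum fun j hj => ?_
        obtain ⟨h2, h3⟩ := hU _ ω j hj
        rw [← hU'] at h3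
        have h4 : E ≤ (slots v (n + 2) (insertHook v j ω)).card + 3 := by
          rw [hE]
          exact_mod_cast card_slots_le_insertHook (mem_halfSpaceFinset.1 hω).1 hj
        rw [← hE]
        rcases le_or_gt E 3 with h5 | h5
        · refine le_trans ?_ (by positivity :
            (0 : ℝ) ≤ (slots v (n + 2) (insertHook v j ω)).card /
              ((hooks v (n + 2) (insertHook v j ω)).card + 5 : ℝ) /
              (hooks v (n + 2) (insertHook v j ω)).card)
          exact div_nonpos_of_nonpos_of_nonneg
            (div_nonpos_of_nonpos_of_nonneg (by linarith) (by linarith)) (by linarith)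
        · have h6 : 0 ≤ E - 3 := by linarith
          refine div_le_div₀ (by positivity) ?_ h2 (by linarith)
          exact div_le_div₀ (by positivity) (by linarith) (by positivity) (by linarith)

lemma sub_le_sq_of_le {φ x ε M : ℝ} (hε : 0 ≤ ε) (hx : 0 ≤ x) (hφ : 0 ≤ φ) (hM : 1 ≤ M)
    (hφM : φ ≤ M) (h : φ ≤ ε + (1 + ε) * x) : φ ^ 2 - 4 * M ^ 2 * ε ≤ x ^ 2 := by
  rcases le_or_gt φ x with h1 | h1
  · have : φ ^ 2 ≤ x ^ 2 := by gcongr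
    have : 0 ≤ 4 * M ^ 2 * ε := by positivity
    linarith
  · have h2 : φ - x ≤ 2 * M * ε := by nlinarith
    have h3 : φ + x ≤ 2 * M := by linarith
    have h4 : (φ - x) * (φ + x) ≤ 2 * M * ε * (2 * M) := by gcongr
    nlinarith

/-- With φ = u₂/u, the mean S/u is at least φ up to `ε`, and by Cauchy–Schwarz its square is at most
Q/u ≤ u₄/u + ε'. As u₄/u = φ · (u₄/u₂), dividing by φ ≥ 1 gives the claim. -/
lemma sub_div_le_div_of_mean_bounds {u u₂ u₄ S Q ε ε' M : ℝ} (hu : 0 < u) (hle : u ≤ u₂)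
    (hM : 1 ≤ M) (hleM : u₂ ≤ u * M) (hε : 0 ≤ ε) (hε' : 0 ≤ ε') (hS : 0 ≤ S)
    (hCS : S ^ 2 ≤ u * Q) (hupper : u₂ ≤ u * ε + (1 + ε) * S) (hlower : Q - u * ε' ≤ u₄) :
    u₂ / u - (4 * M ^ 2 * ε + ε') ≤ u₄ / u₂ := by
  have hu₂ : 0 < u₂ := hu.trans_le hle
  have hφ1 : 1 ≤ u₂ / u := (one_le_div hu).2 hle
  have hsq := sub_le_sq_of_le (φ := u₂ / u) (x := S / u) (ε := ε) (M := M) hε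
    (by positivity) (by positivity) hM ((div_le_iff₀ hu).2 (by linarith)) (by
      rw [div_le_iff₀ hu]
      refine hupper.trans_eq ?_
      field_simp)
  have h3 : (S / u) ^ 2 - ε' ≤ u₄ / u := by
    rw [le_div_iff₀ hu]
    calc ((S / u) ^ 2 - ε') * u = S ^ 2 / u - u * ε' := by field_simp
      _ ≤ _ := by
        refine le_trans (sub_le_sub_right ?_ _) hlower
        rw [div_le_iff₀ hu]
        linarith
  have h4 : u₂ / u * (u₄ / u₂) = u₄ / u := by field_simp
  have h5 : 0 ≤ 4 * M ^ 2 * ε + ε' := by positivity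
  refine le_of_mul_le_mul_left (a := u₂ / u) ?_ (by positivity)
  rw [h4, mul_sub]
  nlinarith

lemma sum_slots_div_hooks_le {v : Site d} {n : ℕ} (hn : 0 < n) {a : ℝ} (ha : 0 < a)
    (hfew : (n : ℝ) ^ 2 * ((halfSpaceFinset d n).filter fun ω =>
      ((hooks v n ω).card : ℝ) < a * n).card ≤ halfSpaceCount d n) :
    ∑ ω ∈ halfSpaceFinset d n, 3 * ((slots v n ω).card / ((hooks v n ω).card + 10 : ℝ)) /
      ((hooks v n ω).card + 5 : ℝ) ≤ halfSpaceCount d n * ((3 / a ^ 2 + 3) / n) := by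
  have hn' : (0 : ℝ) < n := by exact_mod_cast hn
  refine (Finset.sum_le_sum fun ω _ => slots_div_hooks_le hn ha ω).trans ?_
  rw [Finset.sum_add_distrib, Finset.sum_const, nsmul_eq_mul, card_halfSpaceFinset,
    ← Finset.sum_filter, Finset.sum_const, nsmul_eq_mul, add_div, mul_add]
  refine add_le_add_right ?_ _
  rw [mul_div_assoc', le_div_iff₀ hn']
  linarith

/-- Both moment errors are O(1/n): few-hook walks are negligible, and the others have order `n`
hooks, so bounded changes in their number do not matter. A direction `i ≠ 0` is needed for hooks to
preserve the half-space. -/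
lemma exists_almost_increasing {i : Fin d} (hi : i ≠ 0) : ∃ D : ℝ, 0 ≤ D ∧ ∀ᶠ n : ℕ in atTop,
    (halfSpaceCount d (n + 2) : ℝ) / halfSpaceCount d n - D / n ≤
      halfSpaceCount d (n + 4) / halfSpaceCount d (n + 2) := by
  set v : Site d := Pi.single i 1 with hvdef
  have hv0 : v 0 = 0 := by simp [v, hi.symm]
  have hv : ∑ k, |v k| = 1 := sum_abs_single i
  obtain ⟨a, ha, hfew⟩ := exists_card_few_hooks_le hi
  rw [← hvdef] at hfew
  obtain ⟨M, hM⟩ : ∃ M : ℝ, M = sawCount d 2 := ⟨_, rfl⟩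
  have hM1 : 1 ≤ M := by rw [hM]; exact_mod_cast sawCount_pos d 2
  have ha13 : 0 ≤ 13 / a := by positivity
  -- `(M + 13 / a) / n` is the first-moment error and `(3 / a ^ 2 + 3) / n` the second-moment error;
  -- `M` bounds the two-step ratio.
  refine ⟨4 * M ^ 2 * (M + 13 / a) + (3 / a ^ 2 + 3), by positivity, ?_⟩
  filter_upwards [hfew, (tendsto_add_atTop_nat 2).eventually hfew, eventually_gt_atTop 0]
    with n h1 h2 hn
  have hn' : (0 : ℝ) < n := by exact_mod_cast hn
  have hle : (halfSpaceCount d n : ℝ) ≤ halfSpaceCount d (n + 2) := by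
    exact_mod_cast (halfSpaceCount_le_succ n).trans (halfSpaceCount_le_succ (n + 1))
  have hleM : (halfSpaceCount d (n + 2) : ℝ) ≤ halfSpaceCount d n * M := by
    rw [hM]
    exact_mod_cast halfSpaceCount_add_le n 2
  rw [add_div, mul_div_assoc]
  refine sub_div_le_div_of_mean_bounds
    (S := ∑ ω ∈ halfSpaceFinset d n, (slots v n ω).card / ((hooks v n ω).card + 10 : ℝ))
    (Q := ∑ ω ∈ halfSpaceFinset d n, ((slots v n ω).card / ((hooks v n ω).card + 10 : ℝ)) ^ 2)
    (by exact_mod_cast halfSpaceCount_pos d n) hle hM1 hleM (by positivity) (by positivity)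
    (Finset.sum_nonneg fun ω _ => by positivity) ?_ ?_ ?_
  · rw [← card_halfSpaceFinset]
    exact sq_sum_le_card_mul_sum_sq
  · refine (halfSpaceCount_add_two_le hv0 hv ha hn).trans (add_le_add ?_ ?_)
    · rw [mul_div_assoc', le_div_iff₀ hn']
      calc _ ≤ ((n + 2 : ℕ) : ℝ) ^ 2 * ((halfSpaceFinset d (n + 2)).filter fun ω =>
            ((hooks v (n + 2) ω).card : ℝ) < a * (n + 2 : ℕ)).card := by
            rw [mul_comm]
            gcongr
            push_cast
            nlinarith
        _ ≤ halfSpaceCount d n * M := h2.trans hleM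
        _ ≤ _ := by gcongr; linarith
    · refine mul_le_mul_of_nonneg_right ?_ (Finset.sum_nonneg fun ω _ => by positivity)
      rw [← div_div]
      gcongr
      linarith
  · refine le_trans ?_ (sum_sq_le_halfSpaceCount_add_four hv0 hv n)
    rw [Finset.sum_sub_distrib]
    exact sub_le_sub_left (sum_slots_div_hooks_le hn ha h1) _

/-- In dimension one there is no direction for hooks, but the half-space walk is unique and ratios
are trivial. -/
lemma halfSpaceCount_eq_one (h : ∀ i : Fin d, i = 0) (n : ℕ) : halfSpaceCount d n = 1 := by
  refine le_antisymm ((Set.ncard_le_one_iff (halfSpaceWalks_finite d n)).2 ?_) (halfSpaceCount_pos d n)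
  -- The previous position is carried along in the induction, since a step back would revisit it.
  have key : ∀ ω ∈ halfSpaceWalks d n, ∀ j, j ≤ n → (ω j 0 = j ∧ (0 < j → ω (j - 1) 0 = j - 1)) := by
    intro ω hω j
    induction j with
    | zero => intro _; simp [hω.1.1]
    | succ j ih =>
      intro hj
      obtain ⟨h1, h2⟩ := ih (by omega)
      have h3 := hω.1.2.1 j (by omega)
      have h4 := hω.2 (j + 1) (by omega) hj
      rw [Fintype.sum_eq_single 0 fun i hi => absurd (h i) hi, h1] at h3
      refine ⟨?_, fun _ => by simp [h1]⟩
      by_contra hne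
      have h5 : ω (j + 1) 0 = j - 1 := by
        push_cast at hne
        rcases abs_eq (zero_le_one' ℤ) |>.1 h3 with h3 | h3 <;> omega
      have hj0 : 0 < j := by omega
      have h6 : ω (j + 1) = ω (j - 1) := by
        funext i
        rw [h i, h5, h2 hj0]
      have := hω.1.2.2.1 hj (show j - 1 ∈ Set.Iic n by simp; omega) h6
      omega
  intro ω ω' hω hω'
  refine eq_of_forall_le_eq hω.1 hω'.1 fun j hj => funext fun i => ?_
  rw [h i, (key ω hω j hj).1, (key ω' hω' j hj).1]

lemma tendsto_halfSpaceCount_add_two (d : ℕ) [NeZero d] :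
    Tendsto (fun n => (halfSpaceCount d (n + 2) : ℝ) / halfSpaceCount d n) atTop
      (𝓝 (connectiveConstant d ^ 2)) := by
  have hβ := connectiveConstant_pos d
  have h1 : connectiveConstant d ^ 2 = Real.exp (2 * Real.log (connectiveConstant d)) := by
    rw [two_mul, Real.exp_add, Real.exp_log hβ, sq]
  obtain ⟨D, hD, h⟩ : ∃ D : ℝ, 0 ≤ D ∧ ∀ᶠ n : ℕ in atTop,
      (halfSpaceCount d (n + 2) : ℝ) / halfSpaceCount d n - D / n ≤
        halfSpaceCount d (n + 4) / halfSpaceCount d (n + 2) := by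
    by_cases h : ∀ i : Fin d, i = 0
    · exact ⟨0, le_rfl, by simp [halfSpaceCount_eq_one h]⟩
    · push Not at h
      obtain ⟨i, hi⟩ := h
      exact exists_almost_increasing hi
  rw [h1]
  exact tendsto_ratio_of_almost_increasing (fun n => by exact_mod_cast halfSpaceCount_pos d n)
    (tendsto_log_halfSpaceCount d) hD h

end Ratio

/-! ### The ratio limit -/

section RatioOne

variable {d : ℕ} [NeZero d]

lemma exists_irreducibleBridge_length_eq_one (d : ℕ) [NeZero d] :
    ∃ b : IrreducibleBridge d, b.length = 1 := by
  have h0 : (fun _ => 0 : ℕ → Site d) ∈ selfAvoidingWalks d 0 :=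
    ⟨rfl, by simp, by simp [Set.InjOn], by simp⟩
  refine ⟨⟨1, prepend fun _ => 0, le_rfl, prepend_mem h0 (by simp), fun j h1 h2 => ?_,
    fun j hj => by have := hj.1; have := hj.2.1; omega⟩, rfl⟩
  obtain rfl : j = 1 := by omega
  simp [prepend]

lemma halfSpaceCount_cast_pos (n : ℕ) : (0 : ℝ) < halfSpaceCount d n := by
  exact_mod_cast halfSpaceCount_pos d n

lemma tendsto_halfSpaceCount_sub_even (k : ℕ) :
    Tendsto (fun n => (halfSpaceCount d (n - 2 * k) : ℝ) / halfSpaceCount d n) atTop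
      (𝓝 (connectiveConstant d ^ (2 * k))⁻¹) := by
  have hβ := connectiveConstant_pos d
  induction k with
  | zero => simp [(halfSpaceCount_cast_pos _).ne']
  | succ k ih =>
    have h1 : Tendsto (fun n => ((halfSpaceCount d (n - 2 * (k + 1) + 2) : ℝ) /
        halfSpaceCount d (n - 2 * (k + 1)))⁻¹) atTop (𝓝 (connectiveConstant d ^ 2)⁻¹) :=
      ((tendsto_halfSpaceCount_add_two d).comp (tendsto_sub_atTop_nat _)).inv₀ (by positivity)
    have h2 := h1.mul ih
    rw [← mul_inv, ← pow_add, show 2 + 2 * k = 2 * (k + 1) by ring] at h2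
    refine h2.congr' ?_
    filter_upwards [eventually_ge_atTop (2 * (k + 1))] with n hn
    rw [show n - 2 * (k + 1) + 2 = n - 2 * k by omega, inv_div,
      div_mul_div_cancel₀ (halfSpaceCount_cast_pos _).ne']

/-- Divide the renewal inequality at `n + 1` by u_(n+1). Even lengths involve two-step ratios only;
odd lengths give u_n/u_(n+1) times two-step ratios. In the limit u_n/u_(n+1) is at most (1 - E)/(β
O), with E and O the even and odd parts of Kesten's sum, and E + O is nearly 1. -/
lemma eventually_halfSpaceCount_div_succ_lt {x : ℝ} (hx : (connectiveConstant d)⁻¹ < x) :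
    ∀ᶠ n : ℕ in atTop, (halfSpaceCount d n : ℝ) / halfSpaceCount d (n + 1) < x := by
  classical
  have hβ := connectiveConstant_pos d
  set β := connectiveConstant d
  obtain ⟨T₀, hT₀⟩ := exists_finset_lt_sum_inv_pow (d := d) (x := 1 - (x - β⁻¹)) (by linarith)
  obtain ⟨b₁, hb₁⟩ := exists_irreducibleBridge_length_eq_one d
  -- Including the one-step bridge ensures `β * O ≥ 1`, so the division by the odd part does not
  -- amplify the missing mass `x - β⁻¹`.
  set T := insert b₁ T₀
  have hT : 1 - (x - β⁻¹) < ∑ b ∈ T, (β ^ b.length)⁻¹ :=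
    hT₀.trans_le (Finset.sum_le_sum_of_subset_of_nonneg (Finset.subset_insert _ _)
      fun b _ _ => by positivity)
  set Te := T.filter fun b => Even b.length with hTe
  set To := T.filter fun b => ¬ Even b.length with hTo
  have hTsplit : ∑ b ∈ Te, (β ^ b.length)⁻¹ + ∑ b ∈ To, (β ^ b.length)⁻¹ =
      ∑ b ∈ T, (β ^ b.length)⁻¹ := Finset.sum_filter_add_sum_filter_not _ _ _
  have hodd : β⁻¹ ≤ ∑ b ∈ To, (β ^ b.length)⁻¹ := by
    have hmem : b₁ ∈ To := Finset.mem_filter.2 ⟨Finset.mem_insert_self _ _, by simp [hb₁]⟩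
    have := Finset.single_le_sum (f := fun b : IrreducibleBridge d => (β ^ b.length)⁻¹)
      (fun b _ => by positivity) hmem
    simpa [hb₁] using this
  have heven : Tendsto (fun n => ∑ b ∈ Te, (halfSpaceCount d (n + 1 - b.length) : ℝ) /
      halfSpaceCount d (n + 1)) atTop (𝓝 (∑ b ∈ Te, (β ^ b.length)⁻¹)) := by
    refine tendsto_finsetSum _ fun b hb => ?_
    obtain ⟨k, hk⟩ := even_iff_exists_two_mul.1 (Finset.mem_filter.1 hb).2
    rw [hk]
    exact (tendsto_halfSpaceCount_sub_even k).comp (tendsto_add_atTop_nat 1)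
  have hodd' : Tendsto (fun n => ∑ b ∈ To, (halfSpaceCount d (n + 1 - b.length) : ℝ) /
      halfSpaceCount d n) atTop (𝓝 (β * ∑ b ∈ To, (β ^ b.length)⁻¹)) := by
    rw [Finset.mul_sum]
    refine tendsto_finsetSum _ fun b hb => ?_
    obtain ⟨k, hk⟩ := Nat.not_even_iff_odd.1 (Finset.mem_filter.1 hb).2
    have h1 : β * (β ^ b.length)⁻¹ = (β ^ (2 * k))⁻¹ := by
      rw [hk, pow_succ]; field_simp
    rw [h1]
    refine (tendsto_halfSpaceCount_sub_even k).congr fun n => ?_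
    rw [hk, show n + 1 - (2 * k + 1) = n - 2 * k by omega]
  have hSo : 0 < ∑ b ∈ To, (β ^ b.length)⁻¹ := (inv_pos.2 hβ).trans_le hodd
  have hlim := ((tendsto_const_nhds (x := (1 : ℝ))).sub heven).div hodd' (by positivity)
  have hlt : (1 - ∑ b ∈ Te, (β ^ b.length)⁻¹) / (β * ∑ b ∈ To, (β ^ b.length)⁻¹) < x := by
    rw [div_lt_iff₀ (by positivity)]
    set So := ∑ b ∈ To, (β ^ b.length)⁻¹
    have h1 : x * (β * So) = So + (x - β⁻¹) * (β * So) := by field_simp; ring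
    have h2 : 1 ≤ β * So := by
      have := mul_le_mul_of_nonneg_left hodd hβ.le
      rwa [mul_inv_cancel₀ hβ.ne'] at this
    have h3 : x - β⁻¹ ≤ (x - β⁻¹) * (β * So) := le_mul_of_one_le_right (by linarith) h2
    rw [h1]
    linarith
  filter_upwards [hlim.eventually_lt_const hlt, hodd'.eventually_const_lt (mul_pos hβ hSo),
    eventually_ge_atTop (T.sup IrreducibleBridge.length)] with n h1 h2 h3
  refine lt_of_le_of_lt ?_ h1
  simp only [Pi.div_apply]
  rw [le_div_iff₀ h2]
  have h4 := sum_halfSpaceCount_le T (n + 1) fun b hb =>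
    (Finset.le_sup (f := IrreducibleBridge.length) hb).trans (by omega)
  have h5 : ∑ b ∈ T, (halfSpaceCount d (n + 1 - b.length) : ℝ) / halfSpaceCount d (n + 1) ≤ 1 := by
    rw [← Finset.sum_div, div_le_one (halfSpaceCount_cast_pos _)]
    exact_mod_cast h4
  rw [← Finset.sum_filter_add_sum_filter_not T fun b => Even b.length] at h5
  have h6 : (halfSpaceCount d n : ℝ) / halfSpaceCount d (n + 1) *
      ∑ b ∈ To, (halfSpaceCount d (n + 1 - b.length) : ℝ) / halfSpaceCount d n =
      ∑ b ∈ To, (halfSpaceCount d (n + 1 - b.length) : ℝ) / halfSpaceCount d (n + 1) := by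
    rw [Finset.mul_sum]
    refine Finset.sum_congr rfl fun b _ => ?_
    have := halfSpaceCount_cast_pos (d := d) n
    field_simp
  rw [h6]
  linarith

/-- The ratio limit theorem for half-space walks. -/
lemma tendsto_halfSpaceCount_succ_div (d : ℕ) [NeZero d] :
    Tendsto (fun n : ℕ => (halfSpaceCount d (n + 1) : ℝ) / (halfSpaceCount d n : ℝ)) atTop
      (𝓝 (connectiveConstant d)) := by
  have hβ := connectiveConstant_pos d
  set β := connectiveConstant d with hβdef
  have hpos := halfSpaceCount_cast_pos (d := d)
  refine tendsto_order.2 ⟨fun y hy => ?_, fun y hy => ?_⟩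
  · rcases le_or_gt y 0 with hy0 | hy0
    · exact Eventually.of_forall fun n => hy0.trans_lt (div_pos (hpos _) (hpos _))
    · filter_upwards [eventually_halfSpaceCount_div_succ_lt (d := d) (x := y⁻¹)
        (by rw [← hβdef]; gcongr)] with n hn
      rw [← inv_div] at hn
      exact (inv_lt_inv₀ (div_pos (hpos _) (hpos _)) hy0).1 hn
  -- u_(n+1)/u_n is the product of u_(n+2)/u_n, tending to β², and u_(n+1)/u_(n+2), whose limsup is
  -- at most β⁻¹.
  · obtain ⟨x, hx1, hx2⟩ : ∃ x, β⁻¹ < x ∧ β ^ 2 * x < y := by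
      obtain ⟨w, hw1, hw2⟩ := exists_between hy
      refine ⟨w / β ^ 2, ?_, ?_⟩
      · rw [lt_div_iff₀ (by positivity)]
        calc β⁻¹ * β ^ 2 = β := by field_simp
          _ < w := hw1
      · rwa [mul_div_cancel₀ _ (by positivity)]
    have h1 := (tendsto_halfSpaceCount_add_two d).mul_const x
    filter_upwards [h1.eventually_lt_const hx2, (tendsto_add_atTop_nat 1).eventually
      (eventually_halfSpaceCount_div_succ_lt (d := d) hx1)] with n h2 h3
    have := hpos n
    have := hpos (n + 1)
    have := hpos (n + 2)
    calc (halfSpaceCount d (n + 1) : ℝ) / halfSpaceCount d n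
        = halfSpaceCount d (n + 2) / halfSpaceCount d n *
          (halfSpaceCount d (n + 1) / halfSpaceCount d (n + 1 + 1)) := by field_simp
      _ ≤ halfSpaceCount d (n + 2) / halfSpaceCount d n * x := by gcongr
      _ < y := h2

lemma tendsto_halfSpaceCount_sub_div (k : ℕ) :
    Tendsto (fun n => (halfSpaceCount d (n - k) : ℝ) / halfSpaceCount d n) atTop
      (𝓝 (connectiveConstant d ^ k)⁻¹) := by
  have hβ := connectiveConstant_pos d
  induction k with
  | zero => simp [(halfSpaceCount_cast_pos _).ne']
  | succ k ih =>
    have h1 : Tendsto (fun n => ((halfSpaceCount d (n - (k + 1) + 1) : ℝ) /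
        halfSpaceCount d (n - (k + 1)))⁻¹) atTop (𝓝 (connectiveConstant d)⁻¹) :=
      ((tendsto_halfSpaceCount_succ_div d).comp (tendsto_sub_atTop_nat _)).inv₀ (by positivity)
    have h2 := h1.mul ih
    rw [← mul_inv, ← pow_succ'] at h2
    refine h2.congr' ?_
    filter_upwards [eventually_ge_atTop (k + 1)] with n hn
    rw [show n - (k + 1) + 1 = n - k by omega, inv_div,
      div_mul_div_cancel₀ (halfSpaceCount_cast_pos _).ne']

end RatioOne

/-! ### Weak convergence -/

/-! ### Splitting off the first term of an i.i.d. sequence -/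

section InfinitePi

variable {α : Type*} [MeasurableSpace α] (κ : Measure α) [IsProbabilityMeasure κ]

/-- A sequence of independent variables consists of its first term and an independent sequence of
the same law. -/
lemma map_natCons_prod_infinitePi :
    (κ.prod (Measure.infinitePi fun _ : ℕ => κ)).map
      (fun p : α × (ℕ → α) => (fun i => Nat.casesOn i p.1 p.2 : ℕ → α)) =
      Measure.infinitePi fun _ : ℕ => κ := by
  classical
  refine Measure.eq_infinitePi _ fun s t ht => ?_
  have hmeas : Measurable (fun p : α × (ℕ → α) => (fun i => Nat.casesOn i p.1 p.2 : ℕ → α)) := by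
    refine measurable_pi_lambda _ fun i => ?_
    rcases i with _ | i
    · exact measurable_fst
    · exact (measurable_pi_apply i).comp measurable_snd
  -- Padding with `univ` replaces the finite index set by an initial segment, on which 0 and the
  -- successors separate.
  set t' : ℕ → Set α := fun i => if i ∈ s then t i else Set.univ with ht'
  have ht'm : ∀ i, MeasurableSet (t' i) := fun i => by
    simp only [ht']; split_ifs
    · exact ht i
    · exact .univ
  obtain ⟨N, hN⟩ := s.exists_nat_subset_range
  have hpre : (fun p : α × (ℕ → α) => (fun i => Nat.casesOn i p.1 p.2 : ℕ → α)) ⁻¹'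
      (Set.pi s t) = t' 0 ×ˢ Set.pi (Finset.range N) fun i => t' (i + 1) := by
    ext ⟨a, f⟩
    simp only [Set.mem_preimage, Set.mem_pi, Set.mem_prod, ht', Finset.mem_coe]
    constructor
    · intro h
      refine ⟨?_, fun i _ => ?_⟩
      · split_ifs with h0
        · exact h 0 h0
        · trivial
      · split_ifs with h0
        · exact h (i + 1) h0
        · trivial
    · rintro ⟨h0, h⟩ i hi
      rcases i with _ | i
      · simpa [hi] using h0
      · have := Finset.mem_range.1 (hN hi)
        simpa [hi] using h i (Finset.mem_range.2 (by omega))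
  rw [Measure.map_apply hmeas (.pi s.countable_toSet fun i _ => ht i), hpre, Measure.prod_prod,
    Measure.infinitePi_pi _ fun i _ => ht'm _, mul_comm,
    ← Finset.prod_range_succ' (fun i => κ (t' i)) N]
  refine (Finset.prod_subset_one_on_sdiff (fun i hi => ?_) (fun i hi => ?_) fun i hi => ?_).symm
  · have := Finset.mem_range.1 (hN hi)
    exact Finset.mem_range.2 (by omega)
  · simp [ht', (Finset.mem_sdiff.1 hi).2]
  · simp [ht', hi]

lemma infinitePi_inter_preimage_shift {B : Set α} (hB : MeasurableSet B) {A : Set (ℕ → α)}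
    (hA : MeasurableSet A) :
    (Measure.infinitePi fun _ : ℕ => κ) {χ | χ 0 ∈ B ∧ (fun i => χ (i + 1)) ∈ A} =
      κ B * (Measure.infinitePi fun _ : ℕ => κ) A := by
  have hmeas : Measurable (fun p : α × (ℕ → α) => (fun i => Nat.casesOn i p.1 p.2 : ℕ → α)) := by
    refine measurable_pi_lambda _ fun i => ?_
    rcases i with _ | i
    · exact measurable_fst
    · exact (measurable_pi_apply i).comp measurable_snd
  have hshift : Measurable fun (χ : ℕ → α) i => χ (i + 1) :=
    measurable_pi_lambda _ fun i => measurable_pi_apply (i + 1)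
  have hC : MeasurableSet {χ : ℕ → α | χ 0 ∈ B ∧ (fun i => χ (i + 1)) ∈ A} :=
    ((measurable_pi_apply 0) hB).inter (hshift hA)
  conv_lhs => rw [← map_natCons_prod_infinitePi κ]
  rw [Measure.map_apply hmeas hC, ← Measure.prod_prod]
  rfl

end InfinitePi

/-! ### Lower bounds for open sets -/

section Weak

variable {d : ℕ} [NeZero d]

lemma concatenate_eq_joinAt (χ : ℕ → IrreducibleBridge d) :
    concatenate χ = joinAt (χ 0).length (χ 0).path (concatenate fun i => χ (i + 1)) := by
  have hstart : ∀ i, startTime χ (i + 1) = (χ 0).length + startTime (fun i => χ (i + 1)) i := by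
    intro i
    rw [startTime, Finset.sum_range_succ', add_comm]
    rfl
  have hlen := (χ 0).length_pos
  funext t
  have hpath : (χ 0).path (min t (χ 0).length) = (χ 0).path t := by
    rcases le_total t (χ 0).length with h | h
    · rw [min_eq_left h]
    · rw [min_eq_right h, (χ 0).path_mem.1.2.2.2 t h]
  simp only [joinAt, hpath, concatenate]
  rcases t with _ | t
  · simp [(χ 0).path_mem.1.1]
  · rw [Finset.sum_range_succ', add_comm]
    congr 1
    simp only [hstart, Nat.sub_add_eq]
    -- The surplus indices belong to bridges that have not started, because each earlier bridge
    -- takes at least one step.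
    refine (Finset.sum_subset (Finset.range_mono (by omega)) fun i _ hi => ?_).symm
    have := le_startTime (fun i => χ (i + 1)) i
    rw [Finset.mem_range] at hi
    rw [Nat.sub_eq_zero_of_le (by omega)]
    exact (χ (i + 1)).path_mem.1.1

/-- The sequences of bridges such that all walks starting with the concatenation of the first `m`
bridges belong to `G`. -/
def determined : ℕ → Set (ℕ → Site d) → Set (ℕ → IrreducibleBridge d)
  | 0, G => {_χ | ∀ η : ℕ → Site d, η 0 = 0 → η ∈ G}
  | m + 1, G => {χ | (fun i => χ (i + 1)) ∈
      determined m (joinAt (χ 0).length (χ 0).path ⁻¹' G)}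

lemma determined_succ (m : ℕ) (G : Set (ℕ → Site d)) :
    determined (m + 1) G = ⋃ b : IrreducibleBridge d, {χ | χ 0 ∈ ({b} : Set _) ∧
      (fun i => χ (i + 1)) ∈ determined m (joinAt b.length b.path ⁻¹' G)} := by
  ext χ
  simp [determined]

lemma measurableSet_determined (m : ℕ) (G : Set (ℕ → Site d)) :
    MeasurableSet (determined m G) := by
  induction m generalizing G with
  | zero => exact .const _
  | succ m ih =>
    rw [determined_succ]
    refine .iUnion fun b => ((measurable_pi_apply 0)
      (show MeasurableSet ({b} : Set (IrreducibleBridge d)) from trivial)).inter ?_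
    exact (measurable_pi_lambda _ fun i => measurable_pi_apply (i + 1)) (ih _)

lemma determined_subset_succ (m : ℕ) (G : Set (ℕ → Site d)) :
    determined m G ⊆ determined (m + 1) G := by
  induction m generalizing G with
  | zero => exact fun χ h η hη => h _ (by simp [joinAt, hη, (χ 0).path_mem.1.1])
  | succ m ih => exact fun χ h => ih _ h

/-- Every bridge has at least one step, so the first `m` bridges fix the walk up to time `m`. -/
lemma mem_determined (m : ℕ) (G : Set (ℕ → Site d)) (χ : ℕ → IrreducibleBridge d)
    (h : ∀ ω : ℕ → Site d, (∀ j ≤ m, ω j = concatenate χ j) → ω ∈ G) : χ ∈ determined m G := by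
  induction m generalizing G χ with
  | zero =>
    refine fun η hη => h η fun j hj => ?_
    obtain rfl : j = 0 := by omega
    simp [hη, concatenate]
  | succ m ih =>
    refine ih _ _ fun η hη => h _ fun j hj => ?_
    have := (χ 0).length_pos
    rw [concatenate_eq_joinAt]
    simp only [joinAt]
    rw [hη _ (by omega)]

lemma preimage_concatenate_subset {G : Set (ℕ → Site d)} (hG : IsOpen G) :
    concatenate ⁻¹' G ⊆ ⋃ m, determined m G := by
  intro χ hχ
  obtain ⟨I, u, hu, hsub⟩ := isOpen_pi_iff.1 hG _ hχ
  refine Set.mem_iUnion.2 ⟨I.sup id, mem_determined _ _ _ fun ω hω => hsub fun i hi => ?_⟩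
  rw [hω i (Finset.le_sup (f := id) hi)]
  exact (hu i hi).2

open Classical in
lemma halfSpaceMeasure_apply (n : ℕ) (G : Set (ℕ → Site d)) :
    (halfSpaceMeasure d n : Measure (ℕ → Site d)) G =
      ((halfSpaceFinset d n).filter (· ∈ G)).card / (halfSpaceCount d n : ℝ≥0∞) := by
  have h1 : (halfSpaceMeasure d n : Measure (ℕ → Site d)) = uniformOn (halfSpaceWalks d n) := rfl
  have h2 : halfSpaceWalks d n = (halfSpaceFinset d n : Set (ℕ → Site d)) := by
    ext; simp
  have h3 : halfSpaceWalks d n ∩ G =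
      ((halfSpaceFinset d n).filter (· ∈ G) : Finset (ℕ → Site d)) := by
    ext; simp
  rw [h1, ← uniformOn_inter_self (halfSpaceWalks_finite d n), h3, h2, uniformOn_apply_finset,
    card_halfSpaceFinset, Finset.inter_eq_right.2 (Finset.filter_subset _ _)]

/-- The renewal inequality for walks in `G`, normalised by the number of walks. -/
lemma sum_mul_halfSpaceMeasure_le (T : Finset (IrreducibleBridge d)) (G : Set (ℕ → Site d)) (n : ℕ)
    (hT : ∀ b ∈ T, b.length ≤ n) :
    ∑ b ∈ T, ENNReal.ofReal (halfSpaceCount d (n - b.length) / halfSpaceCount d n) *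
      (halfSpaceMeasure d (n - b.length) : Measure (ℕ → Site d))
        (joinAt b.length b.path ⁻¹' G) ≤ (halfSpaceMeasure d n : Measure (ℕ → Site d)) G := by
  classical
  have h0 : ∀ m, (halfSpaceCount d m : ℝ≥0∞) ≠ 0 := fun m => by
    exact_mod_cast (halfSpaceCount_pos d m).ne'
  have h : ∀ b ∈ T, ENNReal.ofReal (halfSpaceCount d (n - b.length) / halfSpaceCount d n) *
      (halfSpaceMeasure d (n - b.length) : Measure (ℕ → Site d)) (joinAt b.length b.path ⁻¹' G) =
      ((halfSpaceFinset d (n - b.length)).filter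
        fun η => joinAt b.length b.path η ∈ G).card / (halfSpaceCount d n : ℝ≥0∞) := by
    intro b _
    rw [halfSpaceMeasure_apply, ENNReal.ofReal_div_of_pos (halfSpaceCount_cast_pos n),
      ENNReal.ofReal_natCast, ENNReal.ofReal_natCast, mul_comm]
    simp only [Set.mem_preimage]
    rw [← mul_div_assoc, ENNReal.div_mul_cancel (h0 _) (ENNReal.natCast_ne_top _)]
  rw [Finset.sum_congr rfl h, halfSpaceMeasure_apply]
  simp only [div_eq_mul_inv]
  rw [← Finset.sum_mul]
  gcongr
  exact_mod_cast sum_card_filter_le T G n hT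

/-- Induction on the number of bridges, conditioning on the first. Finitely many first bridges carry
all but a little of the mass, and for each of them the ratio of counts tends to its probability. -/
lemma eventually_lt_halfSpaceMeasure {κ : Measure (IrreducibleBridge d)} [IsProbabilityMeasure κ]
    (hκ : ∀ b, κ {b} = ENNReal.ofReal (connectiveConstant d ^ b.length)⁻¹) (m : ℕ)
    (G : Set (ℕ → Site d)) {x : ℝ≥0∞}
    (hx : x < (Measure.infinitePi fun _ : ℕ => κ) (determined m G)) :
    ∀ᶠ n : ℕ in atTop, x < (halfSpaceMeasure d n : Measure (ℕ → Site d)) G := by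
  induction m generalizing G x with
  | zero =>
    by_cases h : ∀ η : ℕ → Site d, η 0 = 0 → η ∈ G
    · refine Eventually.of_forall fun n => (hx.trans_le prob_le_one).trans_eq ?_
      exact (uniformOn_eq_one_of (halfSpaceWalks_finite d n) (halfSpaceWalks_nonempty d n)
        fun ω hω => h ω hω.1.1).symm
    · simp [determined, h] at hx
  | succ m ih =>
    set p : IrreducibleBridge d → ℝ≥0∞ := fun b => (Measure.infinitePi fun _ : ℕ => κ)
      (determined m (joinAt b.length b.path ⁻¹' G))
    have hp : ∀ b, p b ≠ ∞ := fun b => measure_ne_top _ _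
    have h1 : x < ∑' b, κ {b} * p b := by
      refine hx.trans_le ?_
      rw [determined_succ]
      refine (measure_iUnion_le _).trans (ENNReal.tsum_le_tsum fun b => le_of_eq ?_)
      exact infinitePi_inter_preimage_shift κ trivial (measurableSet_determined _ _)
    rw [ENNReal.tsum_eq_iSup_sum] at h1
    obtain ⟨T, hT⟩ := lt_iSup_iff.1 h1
    -- The induction hypothesis only bounds the measures from below; truncating them at `p b` turns
    -- this into a limit.
    have h2 : Tendsto (fun n => ∑ b ∈ T,
        ENNReal.ofReal (halfSpaceCount d (n - b.length) / halfSpaceCount d n) *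
        min ((halfSpaceMeasure d (n - b.length) : Measure (ℕ → Site d))
          (joinAt b.length b.path ⁻¹' G)) (p b)) atTop (𝓝 (∑ b ∈ T, κ {b} * p b)) := by
      refine tendsto_finsetSum _ fun b _ => ?_
      refine ENNReal.Tendsto.mul ?_ (.inr (hp b)) ?_ (.inr (measure_ne_top _ _))
      · rw [hκ]
        exact ENNReal.tendsto_ofReal (tendsto_halfSpaceCount_sub_div _)
      · refine tendsto_order.2 ⟨fun y hy => ?_, fun y hy => ?_⟩
        · filter_upwards [(tendsto_sub_atTop_nat b.length).eventually (ih _ hy)] with n hn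
          exact lt_min hn hy
        · exact Eventually.of_forall fun n => (min_le_right _ _).trans_lt hy
    filter_upwards [h2.eventually_const_lt hT, eventually_ge_atTop (T.sup IrreducibleBridge.length)]
      with n h3 h4
    refine h3.trans_le (le_trans ?_ (sum_mul_halfSpaceMeasure_le T G n fun b hb =>
      (Finset.le_sup (f := IrreducibleBridge.length) hb).trans h4))
    gcongr
    exact min_le_left _ _

/-- Portmanteau: liminf bounds on open sets suffice. An open set constrains only finitely many times
near each of its points, so the event of lying in it is exhausted by events determined by finitely
many bridges. -/
lemma tendsto_halfSpaceMeasure (κ : ProbabilityMeasure (IrreducibleBridge d))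
    (hκ : ∀ b, (κ : Measure (IrreducibleBridge d)) {b} =
      ENNReal.ofReal (connectiveConstant d ^ b.length)⁻¹) :
    Tendsto (fun n : ℕ => halfSpaceMeasure d n) atTop (𝓝 (concatenationLaw κ)) := by
  refine tendsto_of_forall_isOpen_le_liminf' fun G hG => ?_
  have h1 : (concatenationLaw κ : Measure (ℕ → Site d)) G = (Measure.infinitePi fun _ : ℕ =>
      (κ : Measure (IrreducibleBridge d))) (concatenate ⁻¹' G) :=
    Measure.map_apply (measurable_concatenate d) hG.measurableSet
  rw [h1]
  refine (measure_mono (preimage_concatenate_subset hG)).trans ?_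
  rw [Monotone.measure_iUnion (monotone_nat_of_le_succ fun m => determined_subset_succ m G)]
  refine iSup_le fun m => le_of_forall_lt fun x hx => ?_
  obtain ⟨y, hxy, hy⟩ := exists_between hx
  refine hxy.trans_le (le_liminf_of_le (by isBoundedDefault) ?_)
  exact (eventually_lt_halfSpaceMeasure hκ m G hy).mono fun n h => h.le

/-- The law of irreducible bridges given by Kesten's relation. -/
noncomputable def bridgePMF (d : ℕ) [NeZero d] : PMF (IrreducibleBridge d) :=
  ⟨fun b => ENNReal.ofReal (connectiveConstant d ^ b.length)⁻¹,
    tsum_inv_pow_eq_one d ▸ ENNReal.summable.hasSum⟩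

end Weak

theorem mainTheorem1 (d : ℕ) [NeZero d] :
    Tendsto (fun n : ℕ => (sawCount d n : ℝ) ^ (1 / (n : ℝ))) atTop
      (𝓝 (connectiveConstant d)) ∧
    Tendsto (fun n : ℕ => (halfSpaceCount d (n + 1) : ℝ) / (halfSpaceCount d n : ℝ)) atTop
      (𝓝 (connectiveConstant d)) ∧
    ∃ κ : ProbabilityMeasure (IrreducibleBridge d),
      (∀ b : IrreducibleBridge d,
        (κ : Measure (IrreducibleBridge d)).real {b} = (connectiveConstant d ^ b.length)⁻¹) ∧
      Tendsto (fun n : ℕ => halfSpaceMeasure d n) atTop (𝓝 (concatenationLaw κ)) := by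
  have hκ : ∀ b, (bridgePMF d).toMeasure {b} =
      ENNReal.ofReal (connectiveConstant d ^ b.length)⁻¹ := fun b =>
    (bridgePMF d).toMeasure_apply_singleton b trivial
  refine ⟨(exists_tendsto_sawCount d).1, tendsto_halfSpaceCount_succ_div d,
    ⟨(bridgePMF d).toMeasure, inferInstance⟩, fun b => ?_, tendsto_halfSpaceMeasure _ hκ⟩
  have hβ := connectiveConstant_pos d
  change ((bridgePMF d).toMeasure {b}).toReal = _
  rw [hκ, ENNReal.toReal_ofReal (by positivity)]
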